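/- Let $m\ge 0$ be an integer. For $t,\rho\in\mathbb R$, $x,\xi,\eta\in\mathbb R^m$ and $b=(b_0,\dots,b_m)\in\mathbb C^{m+1}$ put $$h^+(t,x,\xi)=(1+4t^2+|x|^2+|\xi|^2)^{-\frac{m+1}{2}},$$ $$h_b^-(t,x,\xi)=(1+4t^2+|x|^2+|\xi|^2)^{-\frac{m+2}{2}}\Bigl(b_0(1-2it)+\sum_{j=1}^m b_j(x_j-i\xi_j)\Bigr),$$ $$\psi(\rho,x,\eta)=(1+|x|^2)^{\frac12}\Bigl(\frac{\rho^2}{4}+|\eta|^2\Bigr)^{\frac12},$$ $$\varphi_b(\rho,x,\eta)=\omega\Bigl(\bigl((1+|x|^2)^{\frac12},(\tfrac{\rho^2}{4}+|\eta|^2)^{\frac12}\bigr),\ b_0(1,\tfrac{\rho}{2})+\sum_{j=1}^m b_j(x_j,\eta_j)\Bigr),$$ where $\omega((x,\xi),(y,\eta))=\xi y-x\eta$ is the standard symplectic form on $\mathbb C^2$. Let $K_0(z)=\int_0^\infty e^{-z\cosh s}\,ds$ $(z>0)$ be the modified Bessel function of the second kind. Let $\mathcal F_t$ and $\mathcal F_\xi$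 be the unitary partial Fourier transforms of $L^2(\mathbb R^{1+m+m})$ in the first variable $t\in\mathbb R$ (dual variable $\rho$) and in the last variable $\xi\in\mathbb R^m$ (dual variable $\eta$), with kernels $e^{-2\pi i t\rho}$ and $e^{-2\pi i\langle\xi,\eta\rangle}$. Then $h^+$ and all $h_b^-$ belong to $L^2(\mathbb R^{1+m+m})$, and in $L^2(\mathbb R^{1+m+m})$: 1) $\displaystyle(\mathcal F_t\mathcal F_\xi h^+)(\rho,x,\eta)=\frac{\pi^{\frac{m+1}{2}}}{\Gamma(\frac{m+1}{2})}\,K_0\bigl(2\pi\psi(\rho,x,\eta)\bigr)$; 2) $\displaystyle(\mathcal F_t\mathcal F_\xi h_b^-)(\rho,x,\eta)=\frac{\pi^{\frac{m+2}{2}}}{2\,\Gamma(\frac{m+2}{2})}\,\frac{\varphi_b(\rho,x,\eta)}{\psi(\rho,x,\eta)}\,\exp\bigl(-2\pi\psi(\rho,x,\eta)\bigr)$ for every $b\in\mathbb C^{m+1}$. Moreover, for all $\rho\in\mathbb R$, $x\in\mathbb R^m$ and $\eta\in\mathbb R^m\setminus\{0\}$, both formulas hold pointwise, the left-hand side being the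 iterated integral over $\xi\in\mathbb R^m$ and then over $t\in\mathbb R$, in which each of the two successive integrals converges absolutely. -/

import Mathlib

open scoped FourierTransform

noncomputable section

namespace NonStandardModel

/-- The Euclidean space `ℝᵐ`. -/
abbrev Vec (m : ℕ) : Type := EuclideanSpace ℝ (Fin m)

/-- The space `ℝ^{1+m+m}` of triples `(t, x, ξ)` (or `(ρ, x, η)`), with Lebesgue measure `volume`. -/
abbrev Space (m : ℕ) : Type := ℝ × Vec m × Vec m

/-- `g = 𝓕_ξ f` in `L²(ℝ^{1+m+m})`: both functions are square integrable, and for almost every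
`(t, x)` the slice `g(t, x, ·)` is the `L²(ℝᵐ)`-Fourier transform (Plancherel's extension of
`u ↦ ∫ u(ξ) e^{-2πi⟨ξ,η⟩} dξ`) of the slice `f(t, x, ·)`. -/
def IsPartialFourierXi {m : ℕ} (f g : Space m → ℂ) : Prop :=
  MeasureTheory.MemLp f 2 MeasureTheory.volume ∧
  MeasureTheory.MemLp g 2 MeasureTheory.volume ∧
  ∀ᵐ p : ℝ × Vec m ∂MeasureTheory.volume,
    ∃ (hf : MeasureTheory.MemLp (fun ξ : Vec m => f (p.1, p.2, ξ)) 2 MeasureTheory.volume)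
      (hg : MeasureTheory.MemLp (fun η : Vec m => g (p.1, p.2, η)) 2 MeasureTheory.volume),
      𝓕 hf.toLp = hg.toLp

/-- `g = 𝓕_t f` in `L²(ℝ^{1+m+m})`: both functions are square integrable, and for almost every
`(x, η)` the slice `g(·, x, η)` is the `L²(ℝ)`-Fourier transform (Plancherel's extension of
`u ↦ ∫ u(t) e^{-2πitρ} dt`) of the slice `f(·, x, η)`. -/
def IsPartialFourierT {m : ℕ} (f g : Space m → ℂ) : Prop :=
  MeasureTheory.MemLp f 2 MeasureTheory.volume ∧
  MeasureTheory.MemLp g 2 MeasureTheory.volume ∧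
  ∀ᵐ q : Vec m × Vec m ∂MeasureTheory.volume,
    ∃ (hf : MeasureTheory.MemLp (fun t : ℝ => f (t, q)) 2 MeasureTheory.volume)
      (hg : MeasureTheory.MemLp (fun ρ : ℝ => g (ρ, q)) 2 MeasureTheory.volume),
      𝓕 hf.toLp = hg.toLp

/-- `H = 𝓕_t 𝓕_ξ f` in `L²(ℝ^{1+m+m})`, i.e. `H` represents the vector of the non-standard
`L²`-model that corresponds to the vector `f` of the `N`-picture. -/
def IsFtFxi {m : ℕ} (f H : Space m → ℂ) : Prop :=
  ∃ g : Space m → ℂ, IsPartialFourierXi f g ∧ IsPartialFourierT g H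

/-- The value at `(ρ, x, η)` of `𝓕_t 𝓕_ξ f`, computed as an iterated integral, is `v`:
the inner integrals `∫ f(t,x,ξ) e^{-2πi⟨ξ,η⟩} dξ` and the outer integral over `t`
converge absolutely, and the result is `v`. -/
def HasFtFxiAt {m : ℕ} (f : Space m → ℂ) (ρ : ℝ) (x η : Vec m) (v : ℂ) : Prop :=
  (∀ t : ℝ, MeasureTheory.Integrable (fun ξ : Vec m => f (t, x, ξ)) MeasureTheory.volume) ∧
  MeasureTheory.Integrable (fun t : ℝ => 𝓕 (fun ξ : Vec m => f (t, x, ξ)) η)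
    MeasureTheory.volume ∧
  𝓕 (fun t : ℝ => 𝓕 (fun ξ : Vec m => f (t, x, ξ)) η) ρ = v

/-- The modified Bessel function of the second kind `K_ν(z)` of real order, for `z > 0`:
`K_ν(z) = ∫₀^∞ e^{-z cosh s} cosh(ν s) ds`. -/
def besselK (ν z : ℝ) : ℝ :=
  ∫ s in Set.Ioi (0 : ℝ), Real.exp (-z * Real.cosh s) * Real.cosh (ν * s)

/-- The standard symplectic form on `ℂ²`: `ω((x,ξ),(y,η)) = ξ y - x η`. -/
def omega (X Y : ℂ × ℂ) : ℂ := X.2 * Y.1 - X.1 * Y.2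

/-- `h⁺(t,x,ξ) = (1 + 4t² + |x|² + |ξ|²)^{-(m+1)/2}`. -/
def hPlus (m : ℕ) (p : Space m) : ℂ :=
  (((1 + 4 * p.1 ^ 2 + ‖p.2.1‖ ^ 2 + ‖p.2.2‖ ^ 2) ^ (-(((m : ℝ) + 1) / 2)) : ℝ) : ℂ)

/-- `h_b⁻(t,x,ξ) = (1 + 4t² + |x|² + |ξ|²)^{-(m+2)/2} (b₀(1 - 2it) + ∑ⱼ bⱼ(xⱼ - iξⱼ))`,
where `b = (b₀, b₁, …, b_m)`. -/
def hMinus {m : ℕ} (b : Fin (m + 1) → ℂ) (p : Space m) : ℂ :=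
  (((1 + 4 * p.1 ^ 2 + ‖p.2.1‖ ^ 2 + ‖p.2.2‖ ^ 2) ^ (-(((m : ℝ) + 2) / 2)) : ℝ) : ℂ) *
    (b 0 * (1 - 2 * Complex.I * (p.1 : ℂ)) +
      ∑ j : Fin m, b j.succ * ((p.2.1 j : ℂ) - Complex.I * (p.2.2 j : ℂ)))

/-- `ψ(ρ,x,η) = (1 + |x|²)^{1/2} (ρ²/4 + |η|²)^{1/2}`. -/
def psi {m : ℕ} (p : Space m) : ℝ :=
  √(1 + ‖p.2.1‖ ^ 2) * √(p.1 ^ 2 / 4 + ‖p.2.2‖ ^ 2)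

/-- `φ_b(ρ,x,η) = ω(((1 + |x|²)^{1/2}, (ρ²/4 + |η|²)^{1/2}), b₀(1, ρ/2) + ∑ⱼ bⱼ(xⱼ, ηⱼ))`. -/
def phi {m : ℕ} (b : Fin (m + 1) → ℂ) (p : Space m) : ℂ :=
  omega (((√(1 + ‖p.2.1‖ ^ 2) : ℝ) : ℂ), ((√(p.1 ^ 2 / 4 + ‖p.2.2‖ ^ 2) : ℝ) : ℂ))
    (b 0 • ((1 : ℂ), (p.1 : ℂ) / 2) +
      ∑ j : Fin m, b j.succ • ((p.2.1 j : ℂ), (p.2.2 j : ℂ)))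

end NonStandardModel

end

/-! Both functions are superpositions of Gaussians. With R = 1 + 4t² + |x|² + |ξ|², the Gamma
integral (`rpow_neg_eq_integral`) writes R^(-s) as a constant times ∫ τ^(s-1) e^(-πRτ) dτ over τ >
0. For fixed τ the integrand is Gaussian in ξ and t, times an affine factor in the case of h⁻, so
both transforms are explicit. They multiply by τ^(-m/2) and τ^(-1/2)/2, turn the quadratic form into
B²τ + C²/τ with B² = 1 + |x|², C² = ρ²/4 + |η|², and divide the linear variables by τ.

What remains is ∫ τ^(p-1) e^(-π(B²τ + C²/τ)) dτ. For h⁺ one has p = 0, which gives 2K₀(2πBC). For h⁻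
the affine factor becomes A - D/τ and p = ±1/2, which gives e^(-2πBC)/B and e^(-2πBC)/C; then A/B -
D/C = (CA - BD)/(BC) is φ_b/ψ.

Fubini in τ (`fourier_gaussian_superposition`) justifies the pointwise formulas for η ≠ 0. The L²
statement cannot rest on them: for m = 0 only η = 0 exists, and the transform in ξ of h⁺ is then (1
+ 4t²)^(-1/2), not integrable in t. There the last step is done backwards: the candidate is
integrable in ρ for every η, and its inverse Fourier integral is computed
(`fourierInv_gaussSliceTXi`, `isFtFxi_of_slices`). -/

noncomputable section

namespace NonStandardModel

open MeasureTheory SchwartzMap Real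

/-! ### The L² Fourier transform compared with Fourier integrals. -/

section Plancherel

variable {V : Type*} [NormedAddCommGroup V] [InnerProductSpace ℝ V] [FiniteDimensional ℝ V]
  [MeasurableSpace V] [BorelSpace V]

theorem integral_fourier_mul_eq {f g : V → ℂ} (hf : Integrable f) (hg : Integrable g) :
    ∫ v, 𝓕 f v * g v = ∫ v, f v * 𝓕 g v := by
  have := VectorFourier.integral_fourierIntegral_smul_eq_flip (μ := (volume : Measure V))
    (ν := (volume : Measure V)) (L := innerₗ V) Real.continuous_fourierChar continuous_inner hf hg
  simp only [flip_innerₗ, smul_eq_mul] at this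
  exact this

/-- The L² transform agrees with the distributional one, which is defined by duality with Schwartz
functions. -/
theorem integral_schwartz_mul_fourier (u : Lp (α := V) ℂ 2) (φ : 𝓢(V, ℂ)) :
    ∫ v, φ v * (𝓕 u : Lp (α := V) ℂ 2) v = ∫ v, 𝓕 φ v * u v := by
  have h := congrArg (fun T : 𝓢'(V, ℂ) => T φ) (Lp.fourier_toTemperedDistribution_eq u)
  simp only [TemperedDistribution.fourier_apply, Lp.toTemperedDistribution_apply,
    smul_eq_mul] at h
  exact h.symm

theorem ae_eq_of_integral_schwartz_mul {f g : V → ℂ} (hf : LocallyIntegrable f)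
    (hg : LocallyIntegrable g) (h : ∀ φ : 𝓢(V, ℂ), ∫ v, φ v * f v = ∫ v, φ v * g v) :
    f =ᵐ[volume] g := by
  refine ae_eq_of_integral_contDiff_smul_eq hf hg fun φ hφ hc => ?_
  have h₁ : HasCompactSupport (Complex.ofRealCLM ∘ φ) := hc.comp_left rfl
  have h₂ : ContDiff ℝ (⊤ : ℕ∞) (Complex.ofRealCLM ∘ φ) := by fun_prop
  simpa using h (h₁.toSchwartzMap h₂)

/-- On `L¹ ∩ L²` the `L²`-Fourier transform is given by the Fourier integral. -/
theorem fourier_Lp_ae_eq {f : V → ℂ} (hf : Integrable f) (u : Lp (α := V) ℂ 2)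
    (hu : u =ᵐ[volume] f) : (𝓕 u : Lp (α := V) ℂ 2) =ᵐ[volume] 𝓕 f := by
  refine ae_eq_of_integral_schwartz_mul ((Lp.memLp _).locallyIntegrable (by norm_num))
    (Continuous.locallyIntegrable ?_) fun φ => ?_
  · exact VectorFourier.fourierIntegral_continuous Real.continuous_fourierChar
      (L := innerₗ V) continuous_inner hf
  · rw [integral_schwartz_mul_fourier, ← integral_fourier_mul_eq φ.integrable hf,
      SchwartzMap.fourier_coe]
    exact integral_congr_ae (by filter_upwards [hu] with v hv; rw [hv])

/-- If the inverse Fourier integral of an integrable function is square integrable, then its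
`L²`-Fourier transform is the original function. -/
theorem fourier_Lp_ae_eq_of_fourierInv {f : V → ℂ} (hf : Integrable f) (u : Lp (α := V) ℂ 2)
    (hu : u =ᵐ[volume] 𝓕⁻ f) : (𝓕 u : Lp (α := V) ℂ 2) =ᵐ[volume] f := by
  refine ae_eq_of_integral_schwartz_mul ((Lp.memLp _).locallyIntegrable (by norm_num))
    hf.locallyIntegrable fun φ => ?_
  rw [integral_schwartz_mul_fourier]
  calc ∫ v, 𝓕 φ v * u v = ∫ v, 𝓕 φ v * 𝓕⁻ f v :=
        integral_congr_ae (by filter_upwards [hu] with v hv; rw [hv])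
    -- The reflection exchanges 𝓕 and 𝓕⁻ in both factors, so that self-adjointness of 𝓕 applies to
    -- the integrable f.
    _ = ∫ v, 𝓕 φ (-v) * 𝓕⁻ f (-v) :=
        (integral_neg_eq_self (fun v => 𝓕 φ v * 𝓕⁻ f v) volume).symm
    _ = ∫ v, (𝓕⁻ φ : 𝓢(V, ℂ)) v * 𝓕 f v := by
        congr 1; ext v
        rw [SchwartzMap.fourierInv_coe, SchwartzMap.fourier_coe, fourierInv_eq_fourier_neg,
          fourierInv_eq_fourier_neg, neg_neg]
    _ = ∫ v, φ v * f v := by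
        rw [← integral_fourier_mul_eq (𝓕⁻ φ : 𝓢(V, ℂ)).integrable hf, ← SchwartzMap.fourier_coe,
          FourierTransform.fourier_fourierInv_eq]

theorem exists_toLp_fourier_eq {f : V → ℂ} (hf : Integrable f) (hf2 : MemLp f 2) :
    ∃ hg : MemLp (𝓕 f) 2, 𝓕 hf2.toLp = hg.toLp := by
  have h := fourier_Lp_ae_eq hf hf2.toLp hf2.coeFn_toLp
  refine ⟨(memLp_congr_ae h).1 (Lp.memLp _), Lp.ext (h.trans (MemLp.coeFn_toLp _).symm)⟩

theorem exists_fourier_toLp_eq {f g : V → ℂ} (hf : Integrable f) (hg : MemLp g 2)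
    (h : ∀ v, 𝓕⁻ f v = g v) : ∃ hf2 : MemLp f 2, 𝓕 hg.toLp = hf2.toLp := by
  have h := fourier_Lp_ae_eq_of_fourierInv hf hg.toLp (by
    filter_upwards [hg.coeFn_toLp] with v hv; rw [hv, h])
  refine ⟨(memLp_congr_ae h).1 (Lp.memLp _), Lp.ext (h.trans (MemLp.coeFn_toLp _).symm)⟩

/-- Plancherel on one slice, in a form that can be integrated over the remaining variables. -/
theorem lintegral_enorm_sq_eq {f g : V → ℂ} (hf : MemLp f 2) (hg : MemLp g 2)
    (h : 𝓕 hf.toLp = hg.toLp) : ∫⁻ v, ‖g v‖ₑ ^ 2 = ∫⁻ v, ‖f v‖ₑ ^ 2 := by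
  have h1 : ‖hg.toLp‖ₑ = ‖hf.toLp‖ₑ := by
    rw [← ofReal_norm, ← ofReal_norm, ← h, Lp.norm_fourier_eq]
  rw [Lp.enorm_toLp, Lp.enorm_toLp] at h1
  have e := fun k : V → ℂ => eLpNorm_nnreal_pow_eq_lintegral (μ := (volume : Measure V)) (f := k)
    (p := 2) two_ne_zero
  simp only [NNReal.coe_ofNat, ENNReal.coe_ofNat, ENNReal.rpow_ofNat] at e
  rw [← e, ← e, h1]

end Plancherel

/-! ### Slices of square integrable functions and partial transforms. -/

theorem memLp_two_iff_lintegral {α : Type*} [MeasurableSpace α] {μ : Measure α} {f : α → ℂ}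
    (hf : AEStronglyMeasurable f μ) : MemLp f 2 μ ↔ ∫⁻ a, ‖f a‖ₑ ^ 2 ∂μ < ⊤ := by
  have e := eLpNorm_nnreal_pow_eq_lintegral (μ := μ) (f := f) (p := 2) two_ne_zero
  simp only [NNReal.coe_ofNat, ENNReal.coe_ofNat, ENNReal.rpow_ofNat] at e
  rw [MemLp, and_iff_right hf, ← e, ENNReal.pow_lt_top_iff]
  simp

theorem memLp_two_slice {α β : Type*} [MeasurableSpace α] [MeasurableSpace β] {μ : Measure α}
    {ν : Measure β} [SFinite μ] [SFinite ν] {f : α × β → ℂ} (hf : MemLp f 2 (μ.prod ν)) :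
    ∀ᵐ a ∂μ, MemLp (fun b => f (a, b)) 2 ν := by
  have h1 := hf.1
  have h2 := (memLp_two_iff_lintegral h1).1 hf
  rw [lintegral_prod _ (h1.enorm.pow_const 2)] at h2
  filter_upwards [h1.prodMk_left, ae_lt_top' (h1.enorm.pow_const 2).lintegral_prod_right' h2.ne]
    with a ha hb
  exact (memLp_two_iff_lintegral ha).2 hb

theorem memLp_two_slice_right {α β : Type*} [MeasurableSpace α] [MeasurableSpace β] {μ : Measure α}
    {ν : Measure β} [SFinite μ] [SFinite ν] {f : α × β → ℂ} (hf : MemLp f 2 (μ.prod ν)) :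
    ∀ᵐ b ∂ν, MemLp (fun a => f (a, b)) 2 μ :=
  memLp_two_slice (f := fun p : β × α => f p.swap)
    (hf.comp_measurePreserving Measure.measurePreserving_swap)

/-- The intermediate function g is the Fourier integral in ξ. Only H, not g, must be integrable
along the first variable, so the second transform is identified by Fourier inversion. Slicewise
Plancherel and Tonelli carry square integrability from f to g and from g to H. -/
theorem isFtFxi_of_slices {m : ℕ} {f H : Space m → ℂ} (hf : StronglyMeasurable f)
    (hf2 : MemLp f 2) (hH : AEStronglyMeasurable H)
    (h1 : ∀ t x, Integrable fun ξ => f (t, x, ξ))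
    (h2 : ∀ x η, Integrable fun ρ => H (ρ, x, η))
    (h3 : ∀ x η t, 𝓕⁻ (fun ρ => H (ρ, x, η)) t = 𝓕 (fun ξ => f (t, x, ξ)) η) :
    IsFtFxi f H := by
  set g : Space m → ℂ := fun p => 𝓕 (fun ξ => f (p.1, p.2.1, ξ)) p.2.2 with hgdef
  have hgm : StronglyMeasurable g := by
    simp only [hgdef, Real.fourier_eq]
    refine StronglyMeasurable.integral_prod_right
      (f := fun (p : Space m) (ξ : Vec m) => 𝐞 (-inner ℝ ξ p.2.2) • f (p.1, p.2.1, ξ)) ?_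
    refine StronglyMeasurable.smul (Continuous.stronglyMeasurable ?_)
      (hf.comp_measurable (by fun_prop))
    have := Real.continuous_fourierChar
    fun_prop
  -- Slicing in ξ needs the grouping (ℝ × Vec m) × Vec m.
  have hassoc := (volume_preserving_prodAssoc : MeasurePreserving
    (MeasurableEquiv.prodAssoc : (ℝ × Vec m) × Vec m ≃ᵐ Space m))
  have hfs : ∀ᵐ p : ℝ × Vec m, MemLp (fun ξ => f (p.1, p.2, ξ)) 2 :=
    memLp_two_slice (hf2.comp_measurePreserving hassoc)
  have hX : ∀ᵐ p : ℝ × Vec m, ∃ (hf : MemLp (fun ξ : Vec m => f (p.1, p.2, ξ)) 2)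
      (hg : MemLp (fun η : Vec m => g (p.1, p.2, η)) 2), 𝓕 hf.toLp = hg.toLp := by
    filter_upwards [hfs] with p hp
    exact ⟨hp, exists_toLp_fourier_eq (h1 p.1 p.2) hp⟩
  have hg2 : MemLp g 2 := by
    rw [memLp_two_iff_lintegral hgm.aestronglyMeasurable]
    rw [memLp_two_iff_lintegral hf.aestronglyMeasurable] at hf2
    convert hf2 using 1
    have e : ∀ k : Space m → ℂ, StronglyMeasurable k → ∫⁻ a, ‖k a‖ₑ ^ 2 =
        ∫⁻ p : ℝ × Vec m, ∫⁻ ξ : Vec m, ‖k (p.1, p.2, ξ)‖ₑ ^ 2 := fun k hk => by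
      rw [← hassoc.lintegral_comp (hk.enorm.pow_const 2)]
      exact lintegral_prod (fun a => ‖k (MeasurableEquiv.prodAssoc a)‖ₑ ^ 2)
        ((hk.enorm.pow_const 2).comp hassoc.measurable).aemeasurable
    rw [e g hgm, e f hf]
    refine lintegral_congr_ae ?_
    filter_upwards [hX] with p ⟨ha, hb, hab⟩
    exact lintegral_enorm_sq_eq ha hb hab
  have hT : ∀ᵐ q : Vec m × Vec m, ∃ (hg : MemLp (fun t : ℝ => g (t, q)) 2)
      (hH : MemLp (fun ρ : ℝ => H (ρ, q)) 2), 𝓕 hg.toLp = hH.toLp := by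
    filter_upwards [memLp_two_slice_right (μ := (volume : Measure ℝ))
      (ν := (volume : Measure (Vec m × Vec m))) hg2] with q hq
    exact ⟨hq, exists_fourier_toLp_eq (h2 q.1 q.2) hq (h3 q.1 q.2)⟩
  have hH2 : MemLp H 2 := by
    rw [memLp_two_iff_lintegral hH]
    have hg2' := (memLp_two_iff_lintegral hgm.aestronglyMeasurable).1 hg2
    convert hg2' using 1
    rw [Measure.volume_eq_prod ℝ (Vec m × Vec m), lintegral_prod_symm _ (hH.enorm.pow_const 2),
      lintegral_prod_symm _ (hgm.enorm.pow_const 2).aemeasurable]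
    refine lintegral_congr_ae ?_
    filter_upwards [hT] with p ⟨ha, hb, hab⟩
    exact lintegral_enorm_sq_eq ha hb hab
  exact ⟨g, ⟨hf2, hg2, hX⟩, ⟨hg2, hH2, hT⟩⟩

/-! ### Fourier transforms of Gaussians with affine factors, and of their superpositions. -/

section Gaussian

variable {V : Type*} [NormedAddCommGroup V] [InnerProductSpace ℝ V] [FiniteDimensional ℝ V]
  [MeasurableSpace V] [BorelSpace V]

theorem integrable_gaussian {b : ℝ} (hb : 0 < b) : Integrable fun v : V => rexp (-b * ‖v‖ ^ 2) := by
  have := (GaussianFourier.integrable_cexp_neg_mul_sq_norm_add (V := V) (b := b)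
    (by simpa using hb) 0 0).norm
  refine this.congr (Filter.Eventually.of_forall fun v => ?_)
  simp only [Complex.norm_exp]
  norm_num [← Complex.ofReal_pow, ← Complex.ofReal_mul, ← Complex.ofReal_neg]

theorem integral_gaussian_pi {s : ℝ} (hs : 0 < s) :
    ∫ v : V, rexp (-(π * s) * ‖v‖ ^ 2) = s ^ (-((Module.finrank ℝ V : ℝ) / 2)) := by
  rw [GaussianFourier.integral_rexp_neg_mul_sq_norm (by positivity), rpow_neg hs.le,
    ← inv_rpow hs.le]
  congr 1
  field_simp

theorem fourier_gaussian_real {s : ℝ} (hs : 0 < s) (w : V) :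
    𝓕 (fun v : V => ((rexp (-(π * s) * ‖v‖ ^ 2) : ℝ) : ℂ)) w =
      ((s ^ (-((Module.finrank ℝ V : ℝ) / 2)) * rexp (-(π / s) * ‖w‖ ^ 2) : ℝ) : ℂ) := by
  have h := fourier_gaussian_innerProductSpace (V := V) (b := ((π * s : ℝ) : ℂ))
    (by simpa using (by positivity)) w
  rw [show (π : ℂ) / ((π * s : ℝ) : ℂ) = ((s⁻¹ : ℝ) : ℂ) by
    push_cast; field_simp [Complex.ofReal_ne_zero.2 pi_ne_zero]] at h
  rw [show ((Module.finrank ℝ V : ℂ) / 2) = (((Module.finrank ℝ V : ℝ) / 2 : ℝ) : ℂ) by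
    push_cast; rfl, ← Complex.ofReal_cpow (by positivity), inv_rpow hs.le, ← rpow_neg hs.le] at h
  convert h using 1
  · exact congrArg (fun k : V → ℂ => 𝓕 k w) (by funext v; push_cast; rfl)
  · push_cast
    congr 2
    have : (s : ℂ) ≠ 0 := by exact_mod_cast hs.ne'
    have : (π : ℂ) ≠ 0 := by exact_mod_cast pi_ne_zero
    field_simp

/-- Half of the exponent absorbs the factor r, since r√s ≤ 1 + πsr²/2 ≤ e^(πsr²/2). A linear factor
thus costs s^(-1/2). -/
theorem norm_mul_gaussian_le {s : ℝ} (hs : 0 < s) (r : ℝ) :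
    r * rexp (-(π * s) * r ^ 2) ≤ s ^ (-(1 / 2) : ℝ) * rexp (-(π * (s / 2)) * r ^ 2) := by
  have h2 : r * √s ≤ rexp (π * (s / 2) * r ^ 2) := by
    refine le_trans ?_ (add_one_le_exp _)
    have h3 := sq_sqrt hs.le
    have h4 : (1 : ℝ) ≤ π := by linarith [pi_gt_three]
    have : (r * √s) ^ 2 = s * r ^ 2 := by rw [mul_pow, h3]; ring
    have : 0 ≤ s * r ^ 2 := by positivity
    nlinarith [sq_nonneg (r * √s - 1)]
  have h5 : r ≤ s ^ (-(1 / 2) : ℝ) * rexp (π * (s / 2) * r ^ 2) := by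
    rw [rpow_neg hs.le, ← sqrt_eq_rpow, inv_mul_eq_div, le_div_iff₀ (by positivity)]
    exact h2
  calc r * rexp (-(π * s) * r ^ 2)
      ≤ (s ^ (-(1 / 2) : ℝ) * rexp (π * (s / 2) * r ^ 2)) * rexp (-(π * s) * r ^ 2) := by gcongr
    _ = _ := by rw [mul_assoc, ← exp_add]; ring_nf

theorem integrable_norm_mul_gaussian {s : ℝ} (hs : 0 < s) :
    Integrable fun v : V => ‖v‖ * rexp (-(π * s) * ‖v‖ ^ 2) := by
  refine Integrable.mono' ((integrable_gaussian (V := V)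
    (b := π * (s / 2)) (by positivity)).const_mul (s ^ (-(1 / 2) : ℝ)))
    (Continuous.aestronglyMeasurable (by fun_prop)) (Filter.Eventually.of_forall fun v => ?_)
  rw [norm_of_nonneg (by positivity)]
  exact norm_mul_gaussian_le hs _

omit [FiniteDimensional ℝ V] [MeasurableSpace V] [BorelSpace V] in
theorem hasFDerivAt_gaussian (c : ℝ) (w : V) :
    HasFDerivAt (fun w : V => ((rexp (-c * ‖w‖ ^ 2) : ℝ) : ℂ))
      (Complex.ofRealCLM ∘L (rexp (-c * ‖w‖ ^ 2) • (-c) • (2 : ℝ) • innerSL ℝ w)) w := by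
  have h := (((hasStrictFDerivAt_norm_sq w).hasFDerivAt.const_mul (-c)).exp)
  refine Complex.ofRealCLM.hasFDerivAt.comp w (h.congr_fderiv ?_)
  ext u; simp

/-- Multiplication by -2πi⟨v,u⟩ becomes differentiation along u, applied here to the transformed
Gaussian. -/
theorem fourier_inner_mul_gaussian {s : ℝ} (hs : 0 < s) (u w : V) :
    𝓕 (fun v : V => (inner ℝ v u : ℂ) * ((rexp (-(π * s) * ‖v‖ ^ 2) : ℝ) : ℂ)) w =
      -(Complex.I * inner ℝ w u / s) *
      ((s ^ (-((Module.finrank ℝ V : ℝ) / 2)) * rexp (-(π / s) * ‖w‖ ^ 2) : ℝ) : ℂ) := by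
  set f : V → ℂ := fun v => ((rexp (-(π * s) * ‖v‖ ^ 2) : ℝ) : ℂ) with hf
  have hi : Integrable f := (integrable_gaussian (V := V) (b := π * s) (by positivity)).ofReal
  have hi2 : Integrable fun v => ‖v‖ * ‖f v‖ := by
    refine (integrable_norm_mul_gaussian (V := V) hs).congr (Filter.Eventually.of_forall fun v => ?_)
    simp only [hf, Complex.norm_real, norm_of_nonneg (exp_pos _).le]
  have hi3 : Integrable (VectorFourier.fourierSMulRight (innerSL ℝ) f) := by
    refine Integrable.mono' (hi2.const_mul (2 * π * ‖innerSL ℝ (E := V)‖))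
      hi.1.fourierSMulRight (Filter.Eventually.of_forall fun v => ?_)
    refine (VectorFourier.norm_fourierSMulRight_le _ _ _).trans (le_of_eq (by ring))
  have h1 := Real.hasFDerivAt_fourier hi hi2 w
  have h2 : 𝓕 f = fun w => ((s ^ (-((Module.finrank ℝ V : ℝ) / 2)) : ℝ) : ℂ) *
      ((rexp (-(π / s) * ‖w‖ ^ 2) : ℝ) : ℂ) := by
    ext w; rw [hf, fourier_gaussian_real hs]; push_cast; rfl
  rw [h2] at h1
  have h3 := congrArg (fun T : V →L[ℝ] ℂ => T u)
    (h1.unique ((hasFDerivAt_gaussian (π / s) w).const_mul _))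
  rw [Real.fourier_continuousLinearMap_apply hi3] at h3
  have h4 : (fun v => VectorFourier.fourierSMulRight (innerSL ℝ) f v u) =
      (-(2 * π * Complex.I)) • fun v => (inner ℝ v u : ℂ) * f v := by
    ext v
    rw [VectorFourier.fourierSMulRight_apply, innerSL_apply_apply]
    simp
  have h5 : 𝓕 ((-(2 * π * Complex.I)) • fun v : V => (inner ℝ v u : ℂ) * f v) w =
      (-(2 * π * Complex.I)) * 𝓕 (fun v : V => (inner ℝ v u : ℂ) * f v) w :=
    congrFun (VectorFourier.fourierIntegral_const_smul _ _ _ _ _) w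
  rw [h4, h5] at h3
  have h6 : (2 * π * Complex.I) ≠ 0 := Complex.two_pi_I_ne_zero
  have h7 : (s : ℂ) ≠ 0 := by exact_mod_cast hs.ne'
  apply mul_left_cancel₀ (neg_ne_zero.2 h6)
  rw [h3]
  simp
  field_simp
  rw [Complex.I_sq]
  ring

/-- Expanding L in an orthonormal basis reduces this to real inner products; L itself is complex
valued. -/
theorem fourier_affine_gaussian {s : ℝ} (hs : 0 < s) (α l : ℂ) (L : V →L[ℝ] ℂ) (w : V) :
    𝓕 (fun v : V => (α + l * L v) * ((rexp (-(π * s) * ‖v‖ ^ 2) : ℝ) : ℂ)) w =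
      (α - Complex.I * l * L w / s) *
      ((s ^ (-((Module.finrank ℝ V : ℝ) / 2)) * rexp (-(π / s) * ‖w‖ ^ 2) : ℝ) : ℂ) := by
  set f : V → ℂ := fun v => ((rexp (-(π * s) * ‖v‖ ^ 2) : ℝ) : ℂ) with hf
  set e := stdOrthonormalBasis ℝ V
  have hL : ∀ v, L v = ∑ i, L (e i) * (inner ℝ v (e i) : ℂ) := fun v => by
    conv_lhs => rw [← e.sum_repr' v]
    simp only [map_sum, map_smul, Complex.real_smul, real_inner_comm]
    exact Finset.sum_congr rfl fun i _ => mul_comm _ _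
  have hi : Integrable f := (integrable_gaussian (V := V) (b := π * s) (by positivity)).ofReal
  have hi2 : ∀ u, Integrable fun v : V => (inner ℝ v u : ℂ) * f v := fun u => by
    refine ((integrable_norm_mul_gaussian (V := V) hs).const_mul ‖u‖).mono'
      (Continuous.aestronglyMeasurable (by fun_prop)) (Filter.Eventually.of_forall fun v => ?_)
    rw [norm_mul, Complex.norm_real, Complex.norm_real, norm_of_nonneg (exp_pos _).le, ← mul_assoc]
    gcongr
    rw [mul_comm]
    exact norm_inner_le_norm _ _
  have key : 𝓕 (fun v : V => (α + l * L v) * f v) w =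
      α * 𝓕 f w + ∑ i, l * L (e i) * 𝓕 (fun v : V => (inner ℝ v (e i) : ℂ) * f v) w := by
    simp only [Real.fourier_eq, ← integral_const_mul]
    rw [← integral_finsetSum, ← integral_add]
    · congr 1
      funext v
      simp only [Circle.smul_def, smul_eq_mul]
      rw [hL, add_mul, mul_add, Finset.mul_sum, Finset.sum_mul, Finset.mul_sum]
      congr 1
      · ring
      · exact Finset.sum_congr rfl fun i _ => by ring
    · exact ((Real.fourierIntegral_convergent_iff w).2 hi).const_mul _
    · exact integrable_finsetSum _ fun i _ =>
        ((Real.fourierIntegral_convergent_iff w).2 (hi2 (e i))).const_mul _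
    · exact fun i _ => ((Real.fourierIntegral_convergent_iff w).2 (hi2 (e i))).const_mul _
  rw [key, hf]
  simp only [fourier_inner_mul_gaussian hs, fourier_gaussian_real hs]
  rw [hL w, sub_mul, Finset.mul_sum, Finset.sum_div, Finset.sum_mul, sub_eq_add_neg,
    ← Finset.sum_neg_distrib]
  congr 1
  exact Finset.sum_congr rfl fun i _ => by ring

/-- Products `W(τ) e^{-π c s(τ) |v|²}` are integrable as soon as `W s^{-d/2}` is. -/
theorem integrable_weight_mul_gaussian {W s : ℝ → ℝ} (hW : Measurable W) (hs : Measurable s)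
    (hs0 : ∀ τ, 0 < τ → 0 < s τ) {c : ℝ} (hc : 0 < c)
    (hi : IntegrableOn (fun τ => W τ * s τ ^ (-((Module.finrank ℝ V : ℝ) / 2))) (Set.Ioi 0)) :
    Integrable (fun p : ℝ × V => W p.1 * rexp (-(π * (c * s p.1)) * ‖p.2‖ ^ 2))
      ((volume.restrict (Set.Ioi 0)).prod volume) := by
  have hm : Measurable fun p : ℝ × V => W p.1 * rexp (-(π * (c * s p.1)) * ‖p.2‖ ^ 2) := by
    fun_prop
  have hpos : ∀ᵐ τ ∂(volume.restrict (Set.Ioi (0 : ℝ))), 0 < τ :=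
    ae_restrict_mem measurableSet_Ioi
  refine (integrable_prod_iff hm.aestronglyMeasurable).2 ⟨?_, ?_⟩
  · filter_upwards [hpos] with τ hτ
    have := hs0 τ hτ
    exact (integrable_gaussian (V := V) (b := π * (c * s τ)) (by positivity)).const_mul _
  · refine (hi.norm.mul_const (c ^ (-((Module.finrank ℝ V : ℝ) / 2)))).congr ?_
    filter_upwards [hpos] with τ hτ
    have := hs0 τ hτ
    simp only [norm_mul, norm_of_nonneg (exp_pos _).le]
    rw [integral_const_mul, integral_gaussian_pi (by positivity), mul_rpow hc.le this.le,
      norm_of_nonneg (rpow_nonneg this.le _)]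
    ring

/-- The Fourier transform of a superposition of Gaussians with affine coefficients. -/
theorem fourier_gaussian_superposition {α l : ℝ → ℂ} {s : ℝ → ℝ} (L : V →L[ℝ] ℂ)
    (hα : Measurable α) (hl : Measurable l) (hs : Measurable s) (hs0 : ∀ τ, 0 < τ → 0 < s τ)
    (hiα : IntegrableOn (fun τ => ‖α τ‖ * s τ ^ (-((Module.finrank ℝ V : ℝ) / 2))) (Set.Ioi 0))
    (hil : IntegrableOn (fun τ => ‖l τ‖ * s τ ^ (-(((Module.finrank ℝ V : ℝ) + 1) / 2)))
      (Set.Ioi 0)) :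
    Integrable (fun v : V => ∫ τ in Set.Ioi 0,
      (α τ + l τ * L v) * ((rexp (-(π * s τ) * ‖v‖ ^ 2) : ℝ) : ℂ)) ∧
    ∀ w : V, 𝓕 (fun v : V => ∫ τ in Set.Ioi 0,
      (α τ + l τ * L v) * ((rexp (-(π * s τ) * ‖v‖ ^ 2) : ℝ) : ℂ)) w =
      ∫ τ in Set.Ioi 0, (α τ - Complex.I * l τ * L w / s τ) *
      ((s τ ^ (-((Module.finrank ℝ V : ℝ) / 2)) * rexp (-(π / s τ) * ‖w‖ ^ 2) : ℝ) : ℂ) := by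
  set k : ℝ → V → ℂ := fun τ v => (α τ + l τ * L v) * ((rexp (-(π * s τ) * ‖v‖ ^ 2) : ℝ) : ℂ)
    with hk
  have hpos : ∀ᵐ p : ℝ × V ∂((volume.restrict (Set.Ioi (0 : ℝ))).prod volume), 0 < p.1 :=
    Measure.quasiMeasurePreserving_fst.ae (ae_restrict_mem measurableSet_Ioi)
  have hkm : Measurable (Function.uncurry k) := by
    have := L.continuous.measurable
    simp only [hk, Function.uncurry_def]
    fun_prop
  have hil' : IntegrableOn (fun τ => (‖l τ‖ * s τ ^ (-(1 / 2) : ℝ) * ‖L‖) *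
      s τ ^ (-((Module.finrank ℝ V : ℝ) / 2))) (Set.Ioi 0) := by
    refine (hil.mul_const ‖L‖).congr ?_
    filter_upwards [ae_restrict_mem measurableSet_Ioi] with τ hτ
    rw [show -(((Module.finrank ℝ V : ℝ) + 1) / 2) = -(1 / 2) + -((Module.finrank ℝ V : ℝ) / 2) by
      ring, rpow_add (hs0 τ hτ)]
    ring
  have hki : Integrable (Function.uncurry k) ((volume.restrict (Set.Ioi 0)).prod volume) := by
    have h1 := integrable_weight_mul_gaussian (V := V) hα.norm hs hs0 one_pos hiα
    -- The scale c = 1/2 is the half exponent left after absorbing ‖v‖.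
    have h2 := integrable_weight_mul_gaussian (V := V) (by fun_prop) hs hs0 one_half_pos hil'
    refine (h1.add h2).mono' hkm.aestronglyMeasurable ?_
    filter_upwards [hpos] with p hp
    have hsp := hs0 _ hp
    simp only [hk, Function.uncurry, Pi.add_apply, norm_mul, Complex.norm_real,
      norm_of_nonneg (exp_pos _).le, one_mul]
    calc ‖α p.1 + l p.1 * L p.2‖ * rexp (-(π * s p.1) * ‖p.2‖ ^ 2)
        ≤ (‖α p.1‖ + ‖l p.1‖ * (‖L‖ * ‖p.2‖)) * rexp (-(π * s p.1) * ‖p.2‖ ^ 2) := by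
          gcongr
          refine (norm_add_le _ _).trans ?_
          rw [norm_mul]
          gcongr
          exact L.le_opNorm _
      _ = ‖α p.1‖ * rexp (-(π * s p.1) * ‖p.2‖ ^ 2) +
          ‖l p.1‖ * ‖L‖ * (‖p.2‖ * rexp (-(π * s p.1) * ‖p.2‖ ^ 2)) := by ring
      _ ≤ ‖α p.1‖ * rexp (-(π * s p.1) * ‖p.2‖ ^ 2) +
          ‖l p.1‖ * ‖L‖ * (s p.1 ^ (-(1 / 2) : ℝ) * rexp (-(π * (s p.1 / 2)) * ‖p.2‖ ^ 2)) := by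
          exact add_le_add le_rfl
            (mul_le_mul_of_nonneg_left (norm_mul_gaussian_le hsp _) (by positivity))
      _ = _ := by ring_nf
  refine ⟨hki.integral_prod_right, fun w => ?_⟩
  have hki2 : Integrable (Function.uncurry fun v τ => 𝐞 (-inner ℝ v w) • k τ v)
      (volume.prod (volume.restrict (Set.Ioi 0))) := by
    refine (hki.swap).norm.mono' ?_ (Filter.Eventually.of_forall fun p => ?_)
    · refine AEStronglyMeasurable.smul (Continuous.aestronglyMeasurable ?_) hki.swap.1
      have := Real.continuous_fourierChar
      fun_prop
    · simp [Function.uncurry, Circle.norm_smul]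
  calc 𝓕 (fun v => ∫ τ in Set.Ioi 0, k τ v) w
      = ∫ v, ∫ τ in Set.Ioi 0, 𝐞 (-inner ℝ v w) • k τ v := by
        simp only [Real.fourier_eq, Circle.smul_def, integral_smul]
    _ = ∫ τ in Set.Ioi 0, 𝓕 (k τ) w := by
        rw [integral_integral_swap hki2]
        simp only [Real.fourier_eq]
    _ = _ := setIntegral_congr_fun measurableSet_Ioi fun τ hτ =>
        fourier_affine_gaussian (hs0 τ hτ) _ _ _ _

end Gaussian

/-! ### The integrals over τ: Bessel function and exponentials. -/

theorem integrableOn_rpow_mul_exp {p a : ℝ} (hp : -1 < p) (ha : 0 < a) :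
    IntegrableOn (fun τ : ℝ => τ ^ p * rexp (-(a * τ))) (Set.Ioi 0) := by
  simpa using integrableOn_rpow_mul_exp_neg_mul_rpow hp one_pos ha

theorem integrableOn_rpow_mul_exp_mul_exp_div (p : ℝ) {a b : ℝ} (ha : 0 < a) (hb : 0 < b) :
    IntegrableOn (fun τ : ℝ => τ ^ p * rexp (-(a * τ)) * rexp (-(b / τ))) (Set.Ioi 0) := by
  -- Near 0, e^(-b/τ) ≤ n! τⁿ/bⁿ; this n makes p + n > -1.
  obtain ⟨n, hn⟩ := exists_nat_gt (-1 - p)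
  refine Integrable.mono' ((integrableOn_rpow_mul_exp (p := p + n) (by linarith) ha).const_mul
    (n.factorial / b ^ n)) (Measurable.aestronglyMeasurable (by fun_prop)) ?_
  filter_upwards [ae_restrict_mem measurableSet_Ioi] with τ hτ
  have hτ : 0 < τ := hτ
  rw [norm_of_nonneg (by positivity), rpow_add hτ, rpow_natCast]
  have h1 := pow_div_factorial_le_exp (x := b / τ) (by positivity) n
  have h2 : rexp (-(b / τ)) ≤ n.factorial / b ^ n * τ ^ n := by
    rw [exp_neg]
    refine (inv_anti₀ (by positivity) h1).trans (le_of_eq ?_)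
    rw [div_pow]
    field_simp
  calc _ ≤ τ ^ p * rexp (-(a * τ)) * (n.factorial / b ^ n * τ ^ n) := by gcongr
    _ = _ := by ring

theorem integral_Ioi_eq_integral_exp (h : ℝ → ℝ) {κ : ℝ} (hκ : 0 < κ) :
    ∫ τ in Set.Ioi 0, h τ = ∫ u, κ * rexp u * h (κ * rexp u) := by
  have himg : (fun u : ℝ => κ * rexp u) '' Set.univ = Set.Ioi 0 := by
    ext τ
    simp only [Set.image_univ, Set.mem_range, Set.mem_Ioi]
    refine ⟨fun ⟨u, hu⟩ => hu ▸ by positivity, fun hτ => ⟨log (τ / κ), ?_⟩⟩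
    rw [exp_log (by positivity)]
    field_simp
  have hd : ∀ u ∈ Set.univ, HasDerivWithinAt (fun u : ℝ => κ * rexp u) (κ * rexp u) Set.univ u :=
    fun u _ => ((hasDerivAt_exp u).const_mul κ).hasDerivWithinAt
  have hinj : Set.InjOn (fun u : ℝ => κ * rexp u) Set.univ := fun u _ v _ huv =>
    exp_injective (mul_left_cancel₀ hκ.ne' huv)
  rw [← himg, integral_image_eq_integral_abs_deriv_smul MeasurableSet.univ hd hinj,
    setIntegral_univ]
  congr 1
  funext u
  rw [abs_of_pos (by positivity), smul_eq_mul]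

/-- The substitution τ = (C/B)e^u balances the two terms of the exponent, which becomes -2πBC cosh
u. -/
theorem integral_rpow_mul_exp_eq_integral_cosh (p : ℝ) {B C : ℝ} (hB : 0 < B) (hC : 0 < C) :
    ∫ τ in Set.Ioi 0, τ ^ (p - 1) * rexp (-(π * B ^ 2 * τ + π * C ^ 2 / τ)) =
      (C / B) ^ p * ∫ u, rexp (p * u) * rexp (-(2 * π * (B * C)) * cosh u) := by
  rw [integral_Ioi_eq_integral_exp _ (κ := C / B) (by positivity), ← integral_const_mul]
  congr 1
  funext u
  have e1 : π * B ^ 2 * (C / B * rexp u) + π * C ^ 2 / (C / B * rexp u) =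
      2 * π * (B * C) * cosh u := by
    rw [cosh_eq, exp_neg]
    field_simp
  have e2 : C / B * rexp u * (C / B * rexp u) ^ (p - 1) = (C / B) ^ p * rexp (p * u) := by
    rw [rpow_sub_one (by positivity), mul_div_cancel₀ _ (by positivity),
      mul_rpow (by positivity) (by positivity), ← exp_mul, mul_comm u]
  rw [e1, ← mul_assoc, e2]
  ring_nf

theorem integral_exp_neg_mul_cosh (z : ℝ) :
    ∫ u, rexp (-z * cosh u) = 2 * besselK 0 z := by
  have := integral_comp_abs (f := fun u => rexp (-z * cosh u))
  simp only [cosh_abs] at this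
  rw [this]
  simp [besselK]

/-- Since cosh u = 1 + 2 sinh²(u/2), the substitution v = sinh(u/2) leaves a Gaussian integral. -/
theorem integrable_and_integral_cosh_half {z : ℝ} (hz : 0 < z) :
    Integrable (fun u => 2 * cosh (u / 2) * rexp (-z * cosh u)) ∧
    ∫ u, 2 * cosh (u / 2) * rexp (-z * cosh u) = 4 * rexp (-z) * √(π / (2 * z)) := by
  have himg : (fun u : ℝ => sinh (u / 2)) '' Set.univ = Set.univ := by
    rw [Set.image_univ, Set.range_eq_univ]
    intro v
    obtain ⟨u, hu⟩ := sinh_surjective v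
    exact ⟨2 * u, by simp [hu]⟩
  have hd : ∀ u ∈ Set.univ, HasDerivWithinAt (fun u : ℝ => sinh (u / 2)) (cosh (u / 2) * (1 / 2))
      Set.univ u :=
    fun u _ => ((hasDerivAt_sinh _).comp u ((hasDerivAt_id u).div_const 2)).hasDerivWithinAt
  have hinj : Set.InjOn (fun u : ℝ => sinh (u / 2)) Set.univ := fun u _ v _ huv => by
    have := sinh_injective huv
    linarith
  have key : ∀ u : ℝ, |cosh (u / 2) * (1 / 2)| • (4 * rexp (-z) * rexp (-(2 * z) * sinh (u / 2) ^ 2))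
      = 2 * cosh (u / 2) * rexp (-z * cosh u) := fun u => by
    have h1 : cosh u = 1 + 2 * sinh (u / 2) ^ 2 := by
      have := cosh_two_mul (u / 2)
      rw [mul_div_cancel₀ _ two_ne_zero, cosh_sq] at this
      linarith
    rw [abs_of_pos (by have := cosh_pos (u / 2); positivity), smul_eq_mul, h1,
      show -z * (1 + 2 * sinh (u / 2) ^ 2) = -z + -(2 * z) * sinh (u / 2) ^ 2 by ring, exp_add]
    ring
  have hi : Integrable fun v : ℝ => 4 * rexp (-z) * rexp (-(2 * z) * v ^ 2) :=
    (integrable_exp_neg_mul_sq (by positivity)).const_mul _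
  constructor
  · have := (integrableOn_image_iff_integrableOn_abs_deriv_smul MeasurableSet.univ hd hinj
      (fun v : ℝ => 4 * rexp (-z) * rexp (-(2 * z) * v ^ 2))).1 (by rw [himg]; exact hi.integrableOn)
    rw [integrableOn_univ] at this
    exact this.congr (Filter.Eventually.of_forall key)
  · have := integral_image_eq_integral_abs_deriv_smul MeasurableSet.univ hd hinj
      (fun v : ℝ => 4 * rexp (-z) * rexp (-(2 * z) * v ^ 2))
    rw [himg, setIntegral_univ, setIntegral_univ, integral_const_mul, integral_gaussian] at this
    rw [this]
    exact integral_congr_ae (Filter.Eventually.of_forall fun u => (key u).symm)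

/-- The two integrals agree under u ↦ -u, and their sum has weight 2cosh(u/2). -/
theorem integral_exp_half_mul_cosh {z : ℝ} (hz : 0 < z) :
    ∫ u, rexp (1 / 2 * u) * rexp (-z * cosh u) = 2 * rexp (-z) * √(π / (2 * z)) ∧
    ∫ u, rexp (-(1 / 2) * u) * rexp (-z * cosh u) = 2 * rexp (-z) * √(π / (2 * z)) := by
  obtain ⟨hi, hint⟩ := integrable_and_integral_cosh_half hz
  have hsum : ∀ u : ℝ, rexp (1 / 2 * u) + rexp (-(1 / 2) * u) = 2 * cosh (u / 2) := fun u => by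
    rw [cosh_eq]; ring_nf
  have hsymm : ∫ u, rexp (-(1 / 2) * u) * rexp (-z * cosh u) =
      ∫ u, rexp (1 / 2 * u) * rexp (-z * cosh u) := by
    rw [← integral_neg_eq_self]
    simp
  have i1 : Integrable fun u => rexp (1 / 2 * u) * rexp (-z * cosh u) := by
    refine hi.mono' (Continuous.aestronglyMeasurable (by fun_prop))
      (Filter.Eventually.of_forall fun u => ?_)
    rw [norm_of_nonneg (by positivity), ← hsum u]
    gcongr
    linarith [exp_pos (-(1 / 2) * u)]
  have i2 : Integrable fun u => rexp (-(1 / 2) * u) * rexp (-z * cosh u) := by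
    refine hi.mono' (Continuous.aestronglyMeasurable (by fun_prop))
      (Filter.Eventually.of_forall fun u => ?_)
    rw [norm_of_nonneg (by positivity), ← hsum u]
    gcongr
    linarith [exp_pos (1 / 2 * u)]
  have h := integral_add i1 i2
  simp only [← add_mul, hsum] at h
  rw [hint, hsymm] at h
  constructor <;> linarith

theorem integral_inv_mul_exp {B C : ℝ} (hB : 0 < B) (hC : 0 < C) :
    ∫ τ in Set.Ioi 0, τ ^ (-1 : ℝ) * rexp (-(π * B ^ 2 * τ + π * C ^ 2 / τ)) =
      2 * besselK 0 (2 * π * (B * C)) := by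
  have := integral_rpow_mul_exp_eq_integral_cosh 0 hB hC
  simp only [zero_mul, exp_zero, one_mul, rpow_zero, zero_sub] at this
  rw [this, integral_exp_neg_mul_cosh]

theorem integral_rpow_neg_half_mul_exp {B C : ℝ} (hB : 0 < B) (hC : 0 < C) :
    ∫ τ in Set.Ioi 0, τ ^ (-(1 / 2) : ℝ) * rexp (-(π * B ^ 2 * τ + π * C ^ 2 / τ)) =
      rexp (-2 * π * (B * C)) / B := by
  have := integral_rpow_mul_exp_eq_integral_cosh (1 / 2) hB hC
  rw [(integral_exp_half_mul_cosh (by positivity)).1] at this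
  rw [show (-(1 / 2) : ℝ) = 1 / 2 - 1 by norm_num, this, ← sqrt_eq_rpow]
  have h : √(C / B) * √(π / (2 * (2 * π * (B * C)))) = 1 / (2 * B) := by
    rw [← sqrt_mul (by positivity), show C / B * (π / (2 * (2 * π * (B * C)))) = (1 / (2 * B)) ^ 2 by
      field_simp, sqrt_sq (by positivity)]
  rw [show -(2 * π * (B * C)) = -2 * π * (B * C) by ring]
  linear_combination 2 * rexp (-2 * π * (B * C)) * h

theorem integral_rpow_neg_three_halves_mul_exp {B C : ℝ} (hB : 0 < B) (hC : 0 < C) :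
    ∫ τ in Set.Ioi 0, τ ^ (-(3 / 2) : ℝ) * rexp (-(π * B ^ 2 * τ + π * C ^ 2 / τ)) =
      rexp (-2 * π * (B * C)) / C := by
  have := integral_rpow_mul_exp_eq_integral_cosh (-(1 / 2)) hB hC
  rw [(integral_exp_half_mul_cosh (by positivity)).2] at this
  rw [show (-(3 / 2) : ℝ) = -(1 / 2) - 1 by norm_num, this, rpow_neg (by positivity),
    ← sqrt_eq_rpow, ← sqrt_inv, inv_div]
  have h : √(B / C) * √(π / (2 * (2 * π * (B * C)))) = 1 / (2 * C) := by
    rw [← sqrt_mul (by positivity), show B / C * (π / (2 * (2 * π * (B * C)))) = (1 / (2 * C)) ^ 2 by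
      field_simp, sqrt_sq (by positivity)]
  rw [show -(2 * π * (B * C)) = -2 * π * (B * C) by ring]
  linear_combination 2 * rexp (-2 * π * (B * C)) * h

theorem rpow_neg_eq_integral {s r : ℝ} (hs : 0 < s) (hr : 0 < r) :
    r ^ (-s) = π ^ s / Gamma s * ∫ τ in Set.Ioi 0, τ ^ (s - 1) * rexp (-(π * r * τ)) := by
  rw [integral_rpow_mul_exp_neg_mul_Ioi hs (by positivity), one_div, inv_rpow (by positivity),
    mul_rpow pi_pos.le hr.le, rpow_neg hr.le]
  have := (Gamma_pos_of_pos hs).ne'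
  field_simp

theorem measurable_besselK (ν : ℝ) : Measurable (besselK ν) := by
  refine (StronglyMeasurable.integral_prod_right
    (f := fun z s => rexp (-z * cosh s) * cosh (ν * s)) ?_).measurable
  refine Continuous.stronglyMeasurable ?_
  simp only [Function.uncurry_def]
  fun_prop

/-! ### The Gaussian superpositions for fixed x, and their transforms in ξ and t. -/

section Slices

variable {m : ℕ}

/-- The superposition of Gaussians
`∫ τ^{ν+m/2} e^{-πτ(B²+4t²+|ξ|²)} (a + βt + l L(ξ)) dτ` over `τ > 0`. -/
def gaussSlice (ν B : ℝ) (a β l : ℂ) (L : Vec m →L[ℝ] ℂ) (t : ℝ) (ξ : Vec m) : ℂ :=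
  ∫ τ in Set.Ioi (0 : ℝ), (a + β * t + l * L ξ) *
    ((τ ^ (ν + m / 2) * rexp (-(π * (B ^ 2 + 4 * t ^ 2 + ‖ξ‖ ^ 2) * τ)) : ℝ) : ℂ)

/-- The Fourier transform of `gaussSlice` in `ξ`. -/
def gaussSliceXi (ν B : ℝ) (a β l : ℂ) (L : Vec m →L[ℝ] ℂ) (t : ℝ) (η : Vec m) : ℂ :=
  ∫ τ in Set.Ioi (0 : ℝ), (a + β * t - Complex.I * l * L η / τ) *
    ((τ ^ ν * rexp (-(π * (B ^ 2 + 4 * t ^ 2) * τ + π * ‖η‖ ^ 2 / τ)) : ℝ) : ℂ)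

/-- The Fourier transform of `gaussSlice` in `ξ` and `t`. -/
def gaussSliceTXi (ν B : ℝ) (a β l : ℂ) (L : Vec m →L[ℝ] ℂ) (ρ : ℝ) (η : Vec m) : ℂ :=
  ∫ τ in Set.Ioi (0 : ℝ), (a - Complex.I * (β * ρ / 4 + l * L η) / τ) *
    ((1 / 2 * τ ^ (ν - 1 / 2) *
      rexp (-(π * B ^ 2 * τ + π * (ρ ^ 2 / 4 + ‖η‖ ^ 2) / τ)) : ℝ) : ℂ)

theorem integrableOn_const_mul_rpow_mul_exp (c : ℂ) {p b : ℝ} (hp : c = 0 ∨ -1 < p) (hb : 0 < b) :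
    IntegrableOn (fun τ : ℝ => ‖c‖ * (τ ^ p * rexp (-(b * τ)))) (Set.Ioi 0) := by
  rcases hp with rfl | hp
  · simp
  · exact (integrableOn_rpow_mul_exp hp hb).const_mul _

variable {ν B : ℝ} {a β l : ℂ} {L : Vec m →L[ℝ] ℂ}

/-- The linear term in ξ costs a further τ^(-1/2), and τ^(ν-1/2) is integrable at 0 only for ν >
-1/2. Hence the alternative `hd`: h⁺ has ν = -1/2 without linear terms, h⁻ has ν = 0. -/
theorem fourier_gaussSlice (hB : 0 < B) (hν : -1 < ν) (hd : (β = 0 ∧ l = 0) ∨ -(1 / 2) < ν)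
    (t : ℝ) : Integrable (gaussSlice ν B a β l L t) ∧
      ∀ η, 𝓕 (gaussSlice ν B a β l L t) η = gaussSliceXi ν B a β l L t η := by
  set w : ℝ → ℝ := fun τ => τ ^ (ν + m / 2) * rexp (-(π * (B ^ 2 + 4 * t ^ 2) * τ)) with hw
  have hb : 0 < π * (B ^ 2 + 4 * t ^ 2) := by positivity
  obtain ⟨h1, h2⟩ := fourier_gaussian_superposition (V := Vec m)
    (α := fun τ => (a + β * t) * w τ) (l := fun τ => l * w τ) (s := fun τ => τ) L
    (by fun_prop) (by fun_prop) measurable_id (fun τ h => h)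
    (by
      refine (integrableOn_const_mul_rpow_mul_exp (a + β * t) (Or.inr hν) hb).congr ?_
      filter_upwards [ae_restrict_mem measurableSet_Ioi] with τ (hτ : 0 < τ)
      have : 0 ≤ w τ := by positivity
      rw [norm_mul, Complex.norm_real, norm_of_nonneg this, finrank_euclideanSpace_fin]
      simp only [hw]
      rw [rpow_add hτ, rpow_neg hτ.le]
      have := rpow_pos_of_pos hτ (m / 2)
      field_simp)
    (by
      refine (integrableOn_const_mul_rpow_mul_exp l (p := ν - 1 / 2)
        (hd.imp (fun h => h.2) (fun h => by linarith)) hb).congr ?_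
      filter_upwards [ae_restrict_mem measurableSet_Ioi] with τ (hτ : 0 < τ)
      have : 0 ≤ w τ := by positivity
      rw [norm_mul, Complex.norm_real, norm_of_nonneg this, hw, finrank_euclideanSpace_fin,
        show ν - 1 / 2 = (ν + m / 2) + -(((m : ℝ) + 1) / 2) by ring, rpow_add hτ]
      ring)
  have e : gaussSlice ν B a β l L t = fun ξ => ∫ τ in Set.Ioi 0,
      ((a + β * t) * w τ + l * w τ * L ξ) * ((rexp (-(π * τ) * ‖ξ‖ ^ 2) : ℝ) : ℂ) := by
    funext ξ
    refine integral_congr_ae (Filter.Eventually.of_forall fun τ => ?_)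
    simp only [hw]
    rw [show -(π * (B ^ 2 + 4 * t ^ 2 + ‖ξ‖ ^ 2) * τ) =
      -(π * (B ^ 2 + 4 * t ^ 2) * τ) + -(π * τ) * ‖ξ‖ ^ 2 by ring, exp_add]
    push_cast
    ring
  rw [e]
  refine ⟨h1, fun η => (h2 η).trans (setIntegral_congr_fun measurableSet_Ioi fun τ hτ => ?_)⟩
  have hτ : 0 < τ := hτ
  simp only [hw]
  rw [finrank_euclideanSpace_fin, rpow_add hτ, rpow_neg hτ.le,
    show -(π * (B ^ 2 + 4 * t ^ 2) * τ + π * ‖η‖ ^ 2 / τ) =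
      -(π * (B ^ 2 + 4 * t ^ 2) * τ) + -(π / τ) * ‖η‖ ^ 2 by ring, exp_add]
  have h3 : ((τ ^ ((m : ℝ) / 2) : ℝ) : ℂ) ≠ 0 := by
    exact_mod_cast (rpow_pos_of_pos hτ _).ne'
  push_cast
  field_simp

theorem four_mul_rpow_neg_half {τ : ℝ} (hτ : 0 < τ) :
    (4 * τ) ^ (-(1 / 2) : ℝ) = 1 / 2 * τ ^ (-(1 / 2) : ℝ) := by
  rw [mul_rpow (by norm_num) hτ.le, show (4 : ℝ) = 2 ^ (2 : ℝ) by norm_num, ← rpow_mul (by norm_num)]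
  norm_num [rpow_neg_one]

theorem norm_sub_I_mul_div_le (c d : ℂ) {τ : ℝ} (hτ : 0 < τ) :
    ‖c - Complex.I * d / τ‖ ≤ ‖c‖ + ‖d‖ / τ := by
  refine (norm_sub_le _ _).trans (le_of_eq ?_)
  rw [norm_div, norm_mul, Complex.norm_I, one_mul, Complex.norm_real, norm_of_nonneg hτ.le]

/-- For η ≠ 0 the factor e^(-π‖η‖²/τ) beats every power of τ at 0, so no condition on ν is needed.
-/
theorem fourier_gaussSliceXi (hB : 0 < B) {η : Vec m} (hη : η ≠ 0) :
    Integrable (fun t => gaussSliceXi ν B a β l L t η) ∧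
      ∀ ρ, 𝓕 (fun t => gaussSliceXi ν B a β l L t η) ρ = gaussSliceTXi ν B a β l L ρ η := by
  set w : ℝ → ℝ := fun τ => τ ^ ν * rexp (-(π * B ^ 2 * τ)) * rexp (-(π * ‖η‖ ^ 2 / τ)) with hw
  have hη' : 0 < ‖η‖ := norm_pos_iff.2 hη
  have hb : 0 < π * B ^ 2 := by positivity
  have hc : 0 < π * ‖η‖ ^ 2 := by positivity
  have hint := fun p => integrableOn_rpow_mul_exp_mul_exp_div p hb hc
  obtain ⟨h1, h2⟩ := fourier_gaussian_superposition (V := ℝ)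
    (α := fun τ => (a - Complex.I * (l * L η) / τ) * w τ) (l := fun τ => β * w τ)
    (s := fun τ => 4 * τ) Complex.ofRealCLM
    (by fun_prop) (by fun_prop) (by fun_prop) (fun τ h => by positivity)
    (by
      refine Integrable.mono' (((hint (ν - 1 / 2)).const_mul (1 / 2 * ‖a‖)).add
        ((hint (ν - 3 / 2)).const_mul (1 / 2 * ‖l * L η‖)))
        (Measurable.aestronglyMeasurable (by fun_prop)) ?_
      filter_upwards [ae_restrict_mem measurableSet_Ioi] with τ (hτ : 0 < τ)
      have hw0 : 0 ≤ w τ := by positivity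
      rw [norm_of_nonneg (by positivity), norm_mul, Complex.norm_real, norm_of_nonneg hw0,
        Module.finrank_self, Nat.cast_one, four_mul_rpow_neg_half hτ]
      calc _ ≤ (‖a‖ + ‖l * L η‖ / τ) * w τ * (1 / 2 * τ ^ (-(1 / 2) : ℝ)) := by
            gcongr
            exact norm_sub_I_mul_div_le _ _ hτ
        _ = _ := by
            simp only [hw, Pi.add_apply]
            rw [show ν - 3 / 2 = ν + -(1 / 2) - 1 by ring, rpow_sub_one hτ.ne',
              show ν - 1 / 2 = ν + -(1 / 2) by ring, rpow_add hτ]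
            ring)
    (by
      refine ((hint (ν - 1)).const_mul (‖β‖ / 4)).congr ?_
      filter_upwards [ae_restrict_mem measurableSet_Ioi] with τ (hτ : 0 < τ)
      have hw0 : 0 ≤ w τ := by positivity
      rw [norm_mul, Complex.norm_real, norm_of_nonneg hw0, Module.finrank_self, Nat.cast_one,
        show -(((1 : ℝ) + 1) / 2) = -1 by norm_num, rpow_neg_one, rpow_sub_one hτ.ne']
      simp only [hw]
      field_simp)
  have e : (fun t => gaussSliceXi ν B a β l L t η) = fun t : ℝ => ∫ τ in Set.Ioi 0,
      ((a - Complex.I * (l * L η) / τ) * w τ + β * w τ * Complex.ofRealCLM t) *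
        ((rexp (-(π * (4 * τ)) * ‖t‖ ^ 2) : ℝ) : ℂ) := by
    funext t
    refine integral_congr_ae (Filter.Eventually.of_forall fun τ => ?_)
    simp only [hw, norm_eq_abs, sq_abs, Complex.ofRealCLM_apply]
    rw [show -(π * (B ^ 2 + 4 * t ^ 2) * τ + π * ‖η‖ ^ 2 / τ) =
      -(π * B ^ 2 * τ) + -(π * ‖η‖ ^ 2 / τ) + -(π * (4 * τ)) * t ^ 2 by ring, exp_add, exp_add]
    push_cast
    ring
  rw [e]
  refine ⟨h1, fun ρ => (h2 ρ).trans (setIntegral_congr_fun measurableSet_Ioi fun τ hτ => ?_)⟩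
  have hτ : 0 < τ := hτ
  have h3 : (τ : ℂ) ≠ 0 := by exact_mod_cast hτ.ne'
  simp only [hw, norm_eq_abs, sq_abs, Complex.ofRealCLM_apply]
  rw [Module.finrank_self, Nat.cast_one, four_mul_rpow_neg_half hτ,
    show -(π * B ^ 2 * τ + π * (ρ ^ 2 / 4 + ‖η‖ ^ 2) / τ) =
      -(π * B ^ 2 * τ) + -(π * ‖η‖ ^ 2 / τ) + -(π / (4 * τ)) * ρ ^ 2 by field_simp; ring,
    exp_add, exp_add, show ν - 1 / 2 = ν + -(1 / 2) by ring, rpow_add hτ]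
  push_cast
  field_simp
  ring

theorem inv_four_mul_rpow_neg_half {τ : ℝ} (hτ : 0 < τ) :
    (1 / (4 * τ)) ^ (-(1 / 2) : ℝ) = 2 * τ ^ (1 / 2 : ℝ) := by
  rw [one_div, inv_rpow (by positivity), four_mul_rpow_neg_half hτ, rpow_neg hτ.le]
  field_simp

/-- In ρ the Gaussians have parameter 1/(4τ), so integrating over ρ gains τ^(1/2). This gain makes
the argument work at η = 0 too. -/
theorem fourierInv_gaussSliceTXi (hB : 0 < B) (hν : -1 < ν)
    (hd : (β = 0 ∧ l = 0) ∨ -(1 / 2) < ν) (η : Vec m) :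
    Integrable (fun ρ => gaussSliceTXi ν B a β l L ρ η) ∧
      ∀ t, 𝓕⁻ (fun ρ => gaussSliceTXi ν B a β l L ρ η) t = gaussSliceXi ν B a β l L t η := by
  set w : ℝ → ℝ := fun τ => 1 / 2 * τ ^ (ν - 1 / 2) * rexp (-(π * B ^ 2 * τ)) *
    rexp (-(π * ‖η‖ ^ 2 / τ)) with hw
  have hb : 0 < π * B ^ 2 := by positivity
  have hw1 : ∀ τ, 0 < τ → w τ * (2 * τ ^ (1 / 2 : ℝ)) =
      τ ^ ν * rexp (-(π * B ^ 2 * τ)) * rexp (-(π * ‖η‖ ^ 2 / τ)) := fun τ hτ => by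
    simp only [hw]
    nth_rw 2 [show ν = ν - 1 / 2 + 1 / 2 by ring]
    rw [rpow_add hτ]
    ring
  -- The apparent loss 1/τ is only τ^(-1/2), because ‖η‖e^(-π‖η‖²/τ) ≤ τ^(1/2).
  have hL : ∀ τ, 0 < τ → ‖l * L η‖ / τ * rexp (-(π * ‖η‖ ^ 2 / τ)) ≤
      ‖l‖ * ‖L‖ * τ ^ (-(1 / 2) : ℝ) := fun τ hτ => by
    have h1 : ‖η‖ * rexp (-(π * ‖η‖ ^ 2 / τ)) ≤ τ ^ (1 / 2 : ℝ) := by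
      have := norm_mul_gaussian_le (s := τ⁻¹) (by positivity) ‖η‖
      rw [rpow_neg (by positivity), inv_rpow hτ.le, inv_inv,
        show -(π * τ⁻¹) * ‖η‖ ^ 2 = -(π * ‖η‖ ^ 2 / τ) by ring] at this
      refine this.trans (mul_le_of_le_one_right (by positivity) ?_)
      rw [exp_le_one_iff, neg_mul, neg_nonpos]
      positivity
    calc ‖l * L η‖ / τ * rexp (-(π * ‖η‖ ^ 2 / τ))
        ≤ ‖l‖ * (‖L‖ * ‖η‖) / τ * rexp (-(π * ‖η‖ ^ 2 / τ)) := by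
          rw [norm_mul]
          gcongr
          exact L.le_opNorm _
      _ = ‖l‖ * ‖L‖ / τ * (‖η‖ * rexp (-(π * ‖η‖ ^ 2 / τ))) := by ring
      _ ≤ ‖l‖ * ‖L‖ / τ * τ ^ (1 / 2 : ℝ) := by gcongr
      _ = _ := by
          rw [show (-(1 / 2) : ℝ) = 1 / 2 - 1 by norm_num, rpow_sub_one hτ.ne']
          ring
  obtain ⟨h1, h2⟩ := fourier_gaussian_superposition (V := ℝ)
    (α := fun τ => (a - Complex.I * (l * L η) / τ) * w τ)
    (l := fun τ => (-Complex.I * β / (4 * τ)) * w τ)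
    (s := fun τ => 1 / (4 * τ)) Complex.ofRealCLM
    (by fun_prop) (by fun_prop) (by fun_prop) (fun τ h => by positivity)
    (by
      refine Integrable.mono' ((integrableOn_const_mul_rpow_mul_exp a (Or.inr hν) hb).add
        ((integrableOn_const_mul_rpow_mul_exp l (p := ν - 1 / 2)
        (hd.imp (fun h => h.2) (fun h => by linarith)) hb).mul_const ‖L‖))
        (Measurable.aestronglyMeasurable (by fun_prop)) ?_
      filter_upwards [ae_restrict_mem measurableSet_Ioi] with τ (hτ : 0 < τ)
      have hw0 : 0 ≤ w τ := by positivity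
      rw [norm_of_nonneg (by positivity), norm_mul, Complex.norm_real, norm_of_nonneg hw0,
        Module.finrank_self, Nat.cast_one, inv_four_mul_rpow_neg_half hτ, mul_assoc, hw1 τ hτ]
      have hE : rexp (-(π * ‖η‖ ^ 2 / τ)) ≤ 1 := by
        rw [exp_le_one_iff, neg_nonpos]
        positivity
      calc _ ≤ (‖a‖ + ‖l * L η‖ / τ) *
            (τ ^ ν * rexp (-(π * B ^ 2 * τ)) * rexp (-(π * ‖η‖ ^ 2 / τ))) := by
            gcongr
            exact norm_sub_I_mul_div_le _ _ hτ
        _ = ‖a‖ * (τ ^ ν * rexp (-(π * B ^ 2 * τ))) * rexp (-(π * ‖η‖ ^ 2 / τ)) +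
            τ ^ ν * rexp (-(π * B ^ 2 * τ)) *
              (‖l * L η‖ / τ * rexp (-(π * ‖η‖ ^ 2 / τ))) := by ring
        _ ≤ ‖a‖ * (τ ^ ν * rexp (-(π * B ^ 2 * τ))) * 1 +
            τ ^ ν * rexp (-(π * B ^ 2 * τ)) * (‖l‖ * ‖L‖ * τ ^ (-(1 / 2) : ℝ)) := by
            have := hL τ hτ
            gcongr
        _ = _ := by
            simp only [Pi.add_apply]
            rw [show ν - 1 / 2 = ν + -(1 / 2) by ring, rpow_add hτ]
            ring)
    (by
      refine Integrable.mono' ((integrableOn_const_mul_rpow_mul_exp β (p := ν - 1 / 2)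
        (hd.imp (fun h => h.1) (fun h => by linarith)) hb))
        (Measurable.aestronglyMeasurable (by fun_prop)) ?_
      filter_upwards [ae_restrict_mem measurableSet_Ioi] with τ (hτ : 0 < τ)
      have hw0 : 0 ≤ w τ := by positivity
      have hE : rexp (-(π * ‖η‖ ^ 2 / τ)) ≤ 1 := by
        rw [exp_le_one_iff, neg_nonpos]
        positivity
      rw [norm_of_nonneg (by positivity), norm_mul, Complex.norm_real, norm_of_nonneg hw0,
        Module.finrank_self, Nat.cast_one, show -(((1 : ℝ) + 1) / 2) = -1 by norm_num,
        rpow_neg_one, norm_div, norm_mul, norm_neg, Complex.norm_I, norm_mul, Complex.norm_real,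
        norm_of_nonneg hτ.le]
      calc _ = ‖β‖ * (1 / 2 * (τ ^ (ν - 1 / 2) * rexp (-(π * B ^ 2 * τ)))) *
            rexp (-(π * ‖η‖ ^ 2 / τ)) := by
            simp only [hw]
            norm_num
            field_simp
        _ ≤ ‖β‖ * (1 * (τ ^ (ν - 1 / 2) * rexp (-(π * B ^ 2 * τ)))) * 1 := by
            gcongr
            norm_num
        _ = _ := by ring)
  have e : (fun ρ => gaussSliceTXi ν B a β l L ρ η) = fun ρ : ℝ => ∫ τ in Set.Ioi 0,
      ((a - Complex.I * (l * L η) / τ) * w τ +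
        (-Complex.I * β / (4 * τ)) * w τ * Complex.ofRealCLM ρ) *
        ((rexp (-(π * (1 / (4 * τ))) * ‖ρ‖ ^ 2) : ℝ) : ℂ) := by
    funext ρ
    refine integral_congr_ae (Filter.Eventually.of_forall fun τ => ?_)
    simp only [hw, norm_eq_abs, sq_abs, Complex.ofRealCLM_apply]
    rw [show -(π * B ^ 2 * τ + π * (ρ ^ 2 / 4 + ‖η‖ ^ 2) / τ) =
      -(π * B ^ 2 * τ) + -(π * ‖η‖ ^ 2 / τ) + -(π * (1 / (4 * τ))) * ρ ^ 2 by ring,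
      exp_add, exp_add]
    push_cast
    ring
  rw [e]
  refine ⟨h1, fun t => ?_⟩
  rw [fourierInv_eq_fourier_neg]
  refine (h2 (-t)).trans (setIntegral_congr_fun measurableSet_Ioi fun τ hτ => ?_)
  have hτ : 0 < τ := hτ
  have h3 : (τ : ℂ) ≠ 0 := by exact_mod_cast hτ.ne'
  simp only [norm_eq_abs, sq_abs, Complex.ofRealCLM_apply]
  rw [Module.finrank_self, Nat.cast_one, inv_four_mul_rpow_neg_half hτ,
    show -(π * (B ^ 2 + 4 * t ^ 2) * τ + π * ‖η‖ ^ 2 / τ) =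
      -(π * B ^ 2 * τ) + -(π * ‖η‖ ^ 2 / τ) + -(π / (1 / (4 * τ))) * (-t) ^ 2 by field_simp; ring,
    exp_add, exp_add, ← mul_assoc (τ ^ ν), ← mul_assoc (τ ^ ν), ← hw1 τ hτ]
  push_cast
  field_simp
  ring_nf
  simp only [Complex.I_sq]
  ring

end Slices

/-! ### From superpositions to the two assertions, and square integrability of h⁺ and h⁻. -/

variable {m : ℕ}

theorem isFtFxi_and_hasFtFxiAt_of_eq_gaussSlice {f H : Space m → ℂ} (c : ℂ) (ν : ℝ)
    (a : Vec m → ℂ) (β l : ℂ) (L : Vec m →L[ℝ] ℂ) (hν : -1 < ν)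
    (hd : (β = 0 ∧ l = 0) ∨ -(1 / 2) < ν) (hf : Continuous f) (hf2 : MemLp f 2)
    (hH : Measurable H)
    (hfs : ∀ t x ξ, f (t, x, ξ) = c * gaussSlice ν √(1 + ‖x‖ ^ 2) (a x) β l L t ξ)
    (hHs : ∀ ρ x η, 0 < ρ ^ 2 / 4 + ‖η‖ ^ 2 →
      H (ρ, x, η) = c * gaussSliceTXi ν √(1 + ‖x‖ ^ 2) (a x) β l L ρ η) :
    IsFtFxi f H ∧ ∀ (ρ : ℝ) (x η : Vec m), η ≠ 0 → HasFtFxiAt f ρ x η (H (ρ, x, η)) := by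
  have hB : ∀ x : Vec m, 0 < √(1 + ‖x‖ ^ 2) := fun x => by positivity
  have hmul : ∀ {V : Type} [NormedAddCommGroup V] [InnerProductSpace ℝ V] [MeasurableSpace V]
      [BorelSpace V] [FiniteDimensional ℝ V] (k : V → ℂ) (w : V),
      𝓕 (fun v => c * k v) w = c * 𝓕 k w := fun k w =>
    congrFun (VectorFourier.fourierIntegral_const_smul _ _ _ k c) w
  have h1 : ∀ t x, Integrable (fun ξ => f (t, x, ξ)) := fun t x => by
    simp only [hfs]
    exact (fourier_gaussSlice (hB x) hν hd t).1.const_mul c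
  have h1F : ∀ t x η, 𝓕 (fun ξ => f (t, x, ξ)) η =
      c * gaussSliceXi ν √(1 + ‖x‖ ^ 2) (a x) β l L t η := fun t x η => by
    simp only [hfs]
    rw [hmul, (fourier_gaussSlice (hB x) hν hd t).2]
  have hae : ∀ x η, (fun ρ => H (ρ, x, η)) =ᵐ[volume]
      fun ρ => c * gaussSliceTXi ν √(1 + ‖x‖ ^ 2) (a x) β l L ρ η := fun x η => by
    -- The formula for H is only known away from ρ = 0, η = 0; on each line in ρ this omits at most
    -- one point.
    filter_upwards [Measure.ae_ne volume (0 : ℝ)] with ρ hρ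
    exact hHs ρ x η (by positivity)
  refine ⟨isFtFxi_of_slices hf.stronglyMeasurable hf2 hH.aestronglyMeasurable h1
    (fun x η => ?_) (fun x η t => ?_), fun ρ x η hη => ⟨fun t => h1 t x, ?_, ?_⟩⟩
  · exact ((fourierInv_gaussSliceTXi (hB x) hν hd η).1.const_mul c).congr (hae x η).symm
  · rw [fourierInv_congr_ae (hae x η), h1F, ← (fourierInv_gaussSliceTXi (hB x) hν hd η).2,
      fourierInv_eq_fourier_neg, fourierInv_eq_fourier_neg, hmul]
  · simp only [h1F]
    exact (fourier_gaussSliceXi (hB x) hη).1.const_mul c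
  · have : 0 < ‖η‖ := norm_pos_iff.2 hη
    simp only [h1F]
    rw [hmul, (fourier_gaussSliceXi (hB x) hη).2, hHs ρ x η (by positivity)]

theorem integrable_rpow_space {r : ℝ} (hr : 2 * m + 1 < r) :
    Integrable fun p : Space m =>
      (1 + 4 * p.1 ^ 2 + ‖p.2.1‖ ^ 2 + ‖p.2.2‖ ^ 2) ^ (-(r / 2)) := by
  have : (volume : Measure (Vec m × Vec m)).IsAddHaarMeasure :=
    Measure.prod.instIsAddHaarMeasure volume volume
  have : (volume : Measure (Space m)).IsAddHaarMeasure :=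
    Measure.prod.instIsAddHaarMeasure volume volume
  have h := integrable_rpow_neg_one_add_norm_sq (E := Space m) (μ := volume) (r := r) (by
    simp only [Module.finrank_prod, finrank_euclideanSpace_fin, Module.finrank_self]
    push_cast
    linarith)
  have h0 : 0 ≤ r := by have : (0 : ℝ) ≤ m := m.cast_nonneg; linarith
  refine h.mono' (Measurable.aestronglyMeasurable (by fun_prop))
    (Filter.Eventually.of_forall fun p => ?_)
  rw [norm_of_nonneg (by positivity), ← neg_div]
  refine rpow_le_rpow_of_nonpos (by positivity) ?_ (by linarith)
  -- The product space carries the sup norm, so its square is one of the three squared norms.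
  have h1 : ‖p‖ ^ 2 ≤ 4 * p.1 ^ 2 + ‖p.2.1‖ ^ 2 + ‖p.2.2‖ ^ 2 := by
    have e : ‖p.1‖ ^ 2 = p.1 ^ 2 := by rw [norm_eq_abs, sq_abs]
    rw [Prod.norm_def, Prod.norm_def]
    rcases max_choice ‖p.1‖ (max ‖p.2.1‖ ‖p.2.2‖) with h | h <;> rw [h]
    · nlinarith [sq_nonneg p.1, sq_nonneg ‖p.2.1‖, sq_nonneg ‖p.2.2‖]
    · rcases max_choice ‖p.2.1‖ ‖p.2.2‖ with h | h <;> rw [h] <;>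
        nlinarith [sq_nonneg p.1, sq_nonneg ‖p.2.1‖, sq_nonneg ‖p.2.2‖]
  linarith

theorem memLp_two_of_norm_sq_le {α : Type*} [MeasurableSpace α] {μ : Measure α} {f : α → ℂ}
    {g : α → ℝ} (hf : AEStronglyMeasurable f μ) (hg : Integrable g μ)
    (h : ∀ a, ‖f a‖ ^ 2 ≤ g a) : MemLp f 2 μ := by
  rw [memLp_two_iff_integrable_sq_norm hf]
  exact hg.mono' (hf.norm.pow 2) (Filter.Eventually.of_forall fun a => by
    rw [norm_of_nonneg (by positivity)]; exact h a)

theorem continuous_hPlus (m : ℕ) : Continuous (hPlus m) := by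
  unfold hPlus
  refine Complex.continuous_ofReal.comp (Continuous.rpow_const (by fun_prop) fun p => Or.inl ?_)
  positivity

theorem memLp_hPlus (m : ℕ) : MemLp (hPlus m) 2 := by
  refine memLp_two_of_norm_sq_le (continuous_hPlus m).aestronglyMeasurable
    (integrable_rpow_space (r := 2 * m + 2) (by linarith)) fun p => le_of_eq ?_
  rw [hPlus, Complex.norm_real, norm_of_nonneg (by positivity), ← rpow_natCast,
    ← rpow_mul (by positivity)]
  congr 1
  push_cast
  ring

theorem continuous_hMinus (b : Fin (m + 1) → ℂ) : Continuous (hMinus b) := by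
  unfold hMinus
  refine Continuous.mul (Complex.continuous_ofReal.comp
    (Continuous.rpow_const (by fun_prop) fun p => Or.inl ?_)) (by fun_prop)
  positivity

/-- The linear factor is at most 2M√R, so h⁻ decays like R^(-(m+1)/2), as h⁺ does; its square has
exponent 2m + 2 > 2m + 1 in the norm. -/
theorem memLp_hMinus (b : Fin (m + 1) → ℂ) : MemLp (hMinus b) 2 := by
  set M : ℝ := ∑ j, ‖b j‖
  refine memLp_two_of_norm_sq_le (continuous_hMinus b).aestronglyMeasurable
    ((integrable_rpow_space (r := 2 * m + 2) (by linarith)).const_mul ((2 * M) ^ 2)) fun p => ?_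
  set R := 1 + 4 * p.1 ^ 2 + ‖p.2.1‖ ^ 2 + ‖p.2.2‖ ^ 2 with hR
  have hR0 : 0 < R := by positivity
  have hx : ∀ j, |p.2.1 j| ≤ √R := fun j => by
    refine ((norm_eq_abs _).symm.le.trans (PiLp.norm_apply_le p.2.1 j)).trans ?_
    refine le_sqrt_of_sq_le ?_
    nlinarith [sq_nonneg p.1, sq_nonneg ‖p.2.2‖]
  have hξ : ∀ j, |p.2.2 j| ≤ √R := fun j => by
    refine ((norm_eq_abs _).symm.le.trans (PiLp.norm_apply_le p.2.2 j)).trans ?_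
    refine le_sqrt_of_sq_le ?_
    nlinarith [sq_nonneg p.1, sq_nonneg ‖p.2.1‖]
  have h1 : (1 : ℝ) ≤ √R := by
    refine le_sqrt_of_sq_le ?_
    nlinarith [sq_nonneg p.1, sq_nonneg ‖p.2.1‖, sq_nonneg ‖p.2.2‖]
  have ht : 2 * |p.1| ≤ √R := by
    refine le_sqrt_of_sq_le ?_
    rw [mul_pow, sq_abs]
    nlinarith [sq_nonneg ‖p.2.1‖, sq_nonneg ‖p.2.2‖]
  have hlin : ‖b 0 * (1 - 2 * Complex.I * (p.1 : ℂ)) +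
      ∑ j : Fin m, b j.succ * ((p.2.1 j : ℂ) - Complex.I * (p.2.2 j : ℂ))‖ ≤ 2 * M * √R := by
    refine (norm_add_le _ _).trans ?_
    have e0 : ‖b 0 * (1 - 2 * Complex.I * (p.1 : ℂ))‖ ≤ ‖b 0‖ * (2 * √R) := by
      rw [norm_mul]
      gcongr
      refine (norm_sub_le _ _).trans ?_
      simp
      linarith
    have e1 : ‖∑ j : Fin m, b j.succ * ((p.2.1 j : ℂ) - Complex.I * (p.2.2 j : ℂ))‖ ≤
        ∑ j : Fin m, ‖b j.succ‖ * (2 * √R) := by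
      refine norm_sum_le_of_le _ fun j _ => ?_
      rw [norm_mul]
      gcongr
      refine (norm_sub_le _ _).trans ?_
      simp
      linarith [hx j, hξ j]
    rw [← Finset.sum_mul] at e1
    simp only [M, Fin.sum_univ_succ]
    linarith
  have hRp : (R ^ (-(((m : ℝ) + 2) / 2)) * √R) ^ 2 = R ^ (-((2 * (m : ℝ) + 2) / 2)) := by
    rw [sqrt_eq_rpow, ← rpow_add hR0, ← rpow_natCast, ← rpow_mul hR0.le]
    congr 1
    push_cast
    ring
  rw [hMinus, norm_mul, Complex.norm_real, norm_of_nonneg (by positivity), ← hRp, ← mul_pow]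
  refine pow_le_pow_left₀ (by positivity) ?_ 2
  calc _ ≤ R ^ (-(((m : ℝ) + 2) / 2)) * (2 * M * √R) := by gcongr
    _ = _ := by ring

/-! ### Identification of h⁺, h⁻ and the claimed transforms with Gaussian superpositions. -/

theorem measurable_psi : Measurable (psi (m := m)) := by unfold psi; fun_prop

theorem measurable_phi (b : Fin (m + 1) → ℂ) : Measurable (phi b) := by
  unfold phi omega
  refine Continuous.measurable ?_
  simp only [Prod.fst_add, Prod.snd_add, Prod.smul_fst, Prod.smul_snd, Prod.fst_sum, Prod.snd_sum]
  fun_prop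

theorem hPlus_eq_gaussSlice (t : ℝ) (x ξ : Vec m) :
    hPlus m (t, x, ξ) =
      ((π ^ (((m : ℝ) + 1) / 2) / Gamma (((m : ℝ) + 1) / 2) : ℝ) : ℂ) *
        gaussSlice (-(1 / 2)) √(1 + ‖x‖ ^ 2) 1 0 0 0 t ξ := by
  rw [hPlus, rpow_neg_eq_integral (by positivity) (by positivity), Complex.ofReal_mul, gaussSlice,
    ← integral_complex_ofReal]
  congr 2
  funext τ
  rw [sq_sqrt (by positivity), show ((m : ℝ) + 1) / 2 - 1 = -(1 / 2) + m / 2 by ring]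
  simp
  ring_nf
  simp

theorem besselK_eq_gaussSliceTXi (ρ : ℝ) (x η : Vec m) (h : 0 < ρ ^ 2 / 4 + ‖η‖ ^ 2) :
    ((besselK 0 (2 * π * psi (ρ, x, η)) : ℝ) : ℂ) =
      gaussSliceTXi (-(1 / 2)) √(1 + ‖x‖ ^ 2) 1 0 0 0 ρ η := by
  have h1 := integral_inv_mul_exp (B := √(1 + ‖x‖ ^ 2)) (C := √(ρ ^ 2 / 4 + ‖η‖ ^ 2))
    (by positivity) (by positivity)
  rw [gaussSliceTXi, psi, show besselK 0 (2 * π * (√(1 + ‖x‖ ^ 2) * √(ρ ^ 2 / 4 + ‖η‖ ^ 2))) =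
    1 / 2 * (2 * besselK 0 (2 * π * (√(1 + ‖x‖ ^ 2) * √(ρ ^ 2 / 4 + ‖η‖ ^ 2)))) by ring, ← h1,
    ← integral_const_mul, ← integral_complex_ofReal]
  congr 1
  funext τ
  rw [sq_sqrt h.le, show (-(1 / 2) - 1 / 2 : ℝ) = -1 by norm_num]
  push_cast
  ring

/-- The linear form `ξ ↦ -i ∑ⱼ bⱼ ξⱼ`. -/
def minusForm (b : Fin (m + 1) → ℂ) : Vec m →L[ℝ] ℂ :=
  ∑ j : Fin m, (-Complex.I * b j.succ) • Complex.ofRealCLM ∘L EuclideanSpace.proj j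

theorem minusForm_apply (b : Fin (m + 1) → ℂ) (ξ : Vec m) :
    minusForm b ξ = -Complex.I * ∑ j : Fin m, b j.succ * (ξ j : ℂ) := by
  simp [minusForm, Finset.mul_sum, mul_assoc]

theorem hMinus_eq_gaussSlice (b : Fin (m + 1) → ℂ) (t : ℝ) (x ξ : Vec m) :
    hMinus b (t, x, ξ) =
      ((π ^ (((m : ℝ) + 2) / 2) / Gamma (((m : ℝ) + 2) / 2) : ℝ) : ℂ) *
        gaussSlice 0 √(1 + ‖x‖ ^ 2) (b 0 + ∑ j : Fin m, b j.succ * (x j : ℂ))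
          (-2 * Complex.I * b 0) 1 (minusForm b) t ξ := by
  rw [hMinus, rpow_neg_eq_integral (by positivity) (by positivity), Complex.ofReal_mul, gaussSlice,
    integral_const_mul, ← integral_complex_ofReal, mul_assoc, mul_comm (∫ _ in _, _)]
  congr 2
  · rw [minusForm_apply]
    have hs : ∑ j : Fin m, b j.succ * ((x j : ℂ) - Complex.I * (ξ j : ℂ)) =
        ∑ j : Fin m, b j.succ * (x j : ℂ) + -Complex.I * ∑ j : Fin m, b j.succ * (ξ j : ℂ) := by
      rw [Finset.mul_sum, ← Finset.sum_add_distrib]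
      exact Finset.sum_congr rfl fun j _ => by ring
    rw [hs]
    ring
  · congr 1
    funext τ
    rw [sq_sqrt (by positivity), show ((m : ℝ) + 2) / 2 - 1 = 0 + m / 2 by ring]
    ring_nf

/-- The symplectic form arises as CA - BD when A/B - D/C is put over the common denominator BC = ψ.
-/
theorem phi_div_psi_mul_exp_eq_gaussSliceTXi (b : Fin (m + 1) → ℂ) (ρ : ℝ) (x η : Vec m)
    (h : 0 < ρ ^ 2 / 4 + ‖η‖ ^ 2) :
    1 / 2 * (phi b (ρ, x, η) / (psi (ρ, x, η) : ℂ)) *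
      ((rexp (-2 * π * psi (ρ, x, η)) : ℝ) : ℂ) =
      gaussSliceTXi 0 √(1 + ‖x‖ ^ 2) (b 0 + ∑ j : Fin m, b j.succ * (x j : ℂ))
          (-2 * Complex.I * b 0) 1 (minusForm b) ρ η := by
  set B := √(1 + ‖x‖ ^ 2) with hBdef
  set C := √(ρ ^ 2 / 4 + ‖η‖ ^ 2) with hCdef
  have hB : 0 < B := by positivity
  have hC : 0 < C := by positivity
  have hb : 0 < π * B ^ 2 := by positivity
  have hc : 0 < π * C ^ 2 := by positivity
  have hint : ∀ p : ℝ, IntegrableOn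
      (fun τ => τ ^ p * rexp (-(π * B ^ 2 * τ + π * C ^ 2 / τ))) (Set.Ioi 0) := fun p => by
    refine (integrableOn_rpow_mul_exp_mul_exp_div p hb hc).congr
      (Filter.Eventually.of_forall fun τ => ?_)
    simp only
    rw [neg_add, exp_add, mul_assoc]
  set A : ℂ := b 0 + ∑ j : Fin m, b j.succ * (x j : ℂ) with hA
  set D : ℂ := Complex.I * (-2 * Complex.I * b 0 * ρ / 4 + 1 * minusForm b η) with hD
  -- The factors -i of the linear terms cancel against the i produced by the transform.
  have hD' : D = b 0 * (ρ / 2) + ∑ j : Fin m, b j.succ * (η j : ℂ) := by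
    rw [hD, minusForm_apply]
    linear_combination (-(b 0 * ρ / 2) - ∑ j : Fin m, b j.succ * (η j : ℂ)) * Complex.I_sq
  have key : gaussSliceTXi 0 B A (-2 * Complex.I * b 0) 1 (minusForm b) ρ η =
      1 / 2 * A * ((∫ τ in Set.Ioi 0, τ ^ (-(1 / 2) : ℝ) *
        rexp (-(π * B ^ 2 * τ + π * C ^ 2 / τ)) : ℝ) : ℂ) -
      1 / 2 * D * ((∫ τ in Set.Ioi 0, τ ^ (-(3 / 2) : ℝ) *
        rexp (-(π * B ^ 2 * τ + π * C ^ 2 / τ)) : ℝ) : ℂ) := by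
    rw [← integral_complex_ofReal, ← integral_complex_ofReal, ← integral_const_mul,
      ← integral_const_mul, ← integral_sub ((hint _).ofReal.const_mul _)
        ((hint _).ofReal.const_mul _), gaussSliceTXi]
    refine setIntegral_congr_fun measurableSet_Ioi fun τ (hτ : 0 < τ) => ?_
    rw [← hD, ← sq_sqrt h.le, ← hCdef, show (-(3 / 2) : ℝ) = -(1 / 2) - 1 by norm_num,
      rpow_sub_one hτ.ne', zero_sub]
    push_cast
    ring
  rw [key, integral_rpow_neg_half_mul_exp hB hC, integral_rpow_neg_three_halves_mul_exp hB hC]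
  have hphi : phi b (ρ, x, η) = C * A - B * D := by
    rw [hD', hA]
    simp [phi, omega, ← hBdef, ← hCdef, Prod.fst_sum, Prod.snd_sum]
  have hpsi : psi (ρ, x, η) = B * C := rfl
  have hB' : (B : ℂ) ≠ 0 := by exact_mod_cast hB.ne'
  have hC' : (C : ℂ) ≠ 0 := by exact_mod_cast hC.ne'
  rw [hphi, hpsi]
  push_cast
  field_simp

end NonStandardModel

end

theorem mainTheorem5 (m : ℕ) :
    (NonStandardModel.IsFtFxi (NonStandardModel.hPlus m) (fun p =>
        ((Real.pi ^ (((m : ℝ) + 1) / 2) / Real.Gamma (((m : ℝ) + 1) / 2) *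
          NonStandardModel.besselK 0 (2 * Real.pi * NonStandardModel.psi p) : ℝ) : ℂ)) ∧
      ∀ (ρ : ℝ) (x η : NonStandardModel.Vec m), η ≠ 0 →
        NonStandardModel.HasFtFxiAt (NonStandardModel.hPlus m) ρ x η
          ((Real.pi ^ (((m : ℝ) + 1) / 2) / Real.Gamma (((m : ℝ) + 1) / 2) *
            NonStandardModel.besselK 0 (2 * Real.pi * NonStandardModel.psi (ρ, x, η)) : ℝ) : ℂ)) ∧
    ∀ b : Fin (m + 1) → ℂ,
      NonStandardModel.IsFtFxi (NonStandardModel.hMinus b) (fun p =>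
        ((Real.pi ^ (((m : ℝ) + 2) / 2) / (2 * Real.Gamma (((m : ℝ) + 2) / 2)) : ℝ) : ℂ) *
          (NonStandardModel.phi b p / (NonStandardModel.psi p : ℂ)) *
          ((Real.exp (-2 * Real.pi * NonStandardModel.psi p) : ℝ) : ℂ)) ∧
      ∀ (ρ : ℝ) (x η : NonStandardModel.Vec m), η ≠ 0 →
        NonStandardModel.HasFtFxiAt (NonStandardModel.hMinus b) ρ x η
          (((Real.pi ^ (((m : ℝ) + 2) / 2) / (2 * Real.Gamma (((m : ℝ) + 2) / 2)) : ℝ) : ℂ) *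
            (NonStandardModel.phi b (ρ, x, η) / (NonStandardModel.psi (ρ, x, η) : ℂ)) *
            ((Real.exp (-2 * Real.pi * NonStandardModel.psi (ρ, x, η)) : ℝ) : ℂ)) := by
  open NonStandardModel in
  refine ⟨isFtFxi_and_hasFtFxiAt_of_eq_gaussSlice _ (-(1 / 2)) (fun _ => 1) 0 0 0 (by norm_num)
    (Or.inl ⟨rfl, rfl⟩) (continuous_hPlus m) (memLp_hPlus m) ?_
    (fun t x ξ => hPlus_eq_gaussSlice t x ξ) (fun ρ x η h => ?_), fun b =>
    isFtFxi_and_hasFtFxiAt_of_eq_gaussSlice _ 0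
      (fun x => b 0 + ∑ j : Fin m, b j.succ * (x j : ℂ)) (-2 * Complex.I * b 0) 1 (minusForm b)
    (by norm_num) (Or.inr (by norm_num)) (continuous_hMinus b) (memLp_hMinus b) ?_
    (fun t x ξ => hMinus_eq_gaussSlice b t x ξ) (fun ρ x η h => ?_)⟩
  · exact Complex.measurable_ofReal.comp
      (((measurable_besselK 0).comp (measurable_psi.const_mul _)).const_mul _)
  · rw [← besselK_eq_gaussSliceTXi ρ x η h, Complex.ofReal_mul]
  · have := measurable_psi (m := m)
    have := measurable_phi b
    fun_prop
  · rw [← phi_div_psi_mul_exp_eq_gaussSliceTXi b ρ x η h]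
    push_cast
    ring
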